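/- A bidding mean-payoff game $G=\langle V,E,w\rangle$ consists of a finite directed graph without dead ends and weights $w:V\to\mathbb Z$. Min and Max have budgets that sum to $1$. In each round both submit bids in $[0,1]$ simultaneously; the higher bidder pays his bid to the other player and moves the token to a neighbour of the current vertex. Equal bids are resolved by an arbitrary fixed tie-breaking mechanism, which may depend on the history and on the two actions. A strategy maps finite histories (vertices, winning bids, winners) to a bid and a neighbour; it is legal for an initial budget if, whatever the start vertex and the opponent's strategy, its bid never exceeds the available budget. After $n$ rounds through $v_0,\dots,v_n$ the energy is $E_n=\sum_{i<n}w(v_i)$, and the mean-payoff value is $\liminf_{n\to\infty}E_n/n$. The threshold $\mathrm{Thresh}(v)$ is the least $t\in[0,1]$ such that with every initial budget $B\in(t,1]$ at $v$ Min has a legal strategy that guarantees a non-positive value against every legal Max strategy. (If $t$ moreover has the property that with every budget in $(1-t,1]$ Max can guarantee a strictly positive value, then necessarily $t=\mathrm{Thresh}(v)$.) A simple rule assigns to each vertex a neighbour to move to upon winning and a bid that is a selection, by polynomial inequalities, between at most $K$ polynomials in Min's current budget and the current energy. A Min strategy is memoryless if it is a concatenation of simple rules of the following kind: the rule in use is determined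 by the current vertex and Min's budget at the moment at which it was started; one is started at the beginning, and a new one each time the energy turns from non-positive to positive. Here $K$ is an absolute constant. **Theorem.** There is a constant $K$ such that for every bidding mean-payoff game the following hold. (1) If $v\in V$ and Min's initial budget $B\le 1$ exceeds $\mathrm{Thresh}(v)$, then Min has a legal memoryless strategy (for this $K$) that guarantees a non-positive mean-payoff value from $v$. (2) Suppose that $G$ is strongly connected and $u\in V$. Let $W:V\to\mathbb R$ be a weighted Richman function with respect to $u$: with $\widehat W(u)=0$ and $\widehat W(x)=W(x)$ for $x\ne u$, $$W(v)=\tfrac12\big(\widehat W(v^+)+\widehat W(v^-)\big)+w(v)\qquad(v\in V),$$ where $v^+$ and $v^-$ are neighbours of $v$ with maximal and minimal $\widehat W$. Suppose $W(u)\le 0$. Put $b(v)=\frac12(\widehat W(v^+)-\widehat W(v^-))$, $b_M=\max_v|b(v)|$, $w_M=\max_v|W(v)|$. Let $B\le 1$ be Min's initial budget, $k\in\mathbb N$ the initial energy, and $N\ge1$ an integer with $B>(k+b_M+w_M)/N$. Let $f_m$ be the strategy that at $v$ bids $b(v)/N$ and moves to $v^-$ upon winning (for any choice of the minimizing neighbours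 $v^-$). Then: (a) for every Max strategy and every finite outcome of $f_m$ from any $v$ to any $v'$, with energy $E$ and total net payment $P$ of Min, $E+N\cdot P\le\widehat W(v)-\widehat W(v')$; (b) if the play starts at $u$ and Max plays a legal strategy for the budget $1-B$, then, when the current energy (initial energy included) is $e$, Min's budget is at least $(e+b_M)/N$; in particular Min can afford his bid as long as $e\ge0$; and either the energy at some time is at most $0$, or it is at most $N-b_M$ throughout. -/

import Mathlib

universe u

namespace BidMP

open Filter

/-- The two players of a mean-payoff game. -/
inductive Player where
  | min
  | max
  deriving DecidableEq

/-- A mean-payoff game: a directed graph without dead ends whose vertices carry integer weights.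
(Finiteness of the vertex set is a hypothesis of the theorem.) -/
structure Game (V : Type u) where
  Adj : V → V → Prop
  w : V → ℤ
  exists_adj : ∀ v, ∃ x, Adj v x

/-- An action: a bid, and the vertex to move to upon winning the bidding. -/
structure Action (V : Type u) where
  bid : ℝ
  move : V

/-- Finite histories `v₀, ⟨v₁, b₁, i₁⟩, …, ⟨vₖ, bₖ, iₖ⟩`: in round `j`, player `iⱼ` won the bidding
with the bid `bⱼ`, paid it to the other player and moved the token to `vⱼ`. -/
inductive History (V : Type u) where
  | start (v : V) : History V
  | step (h : History V) (v : V) (b : ℝ) (i : Player) : History V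

namespace History

variable {V : Type u}

/-- The vertex that carries the token. -/
def cur : History V → V
  | start v => v
  | step _ v _ _ => v

/-- The sum of the payments of player `i`; being paid counts negatively. -/
def pay (i : Player) : History V → ℝ
  | start _ => 0
  | step h _ b j => h.pay i + if j = i then b else -b

/-- The energy: the sum of the weights of all vertices but the last one. -/
def energy (G : Game V) : History V → ℤ
  | start _ => 0
  | step h _ _ _ => h.energy G + G.w h.cur

end History

/-- A strategy assigns to each history a bid in `[0,1]` and a neighbour of the current vertex. -/
structure Strategy {V : Type u} (G : Game V) where
  act : History V → Action V
  bid_mem : ∀ h, (act h).bid ∈ Set.Icc (0 : ℝ) 1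
  move_adj : ∀ h, G.Adj h.cur (act h).move

/-- A tie-breaking mechanism: given the history and the two actions (of Min and of Max), it names
the winner of a bidding in which the bids are equal. -/
abbrev TieBreak (V : Type u) := History V → Action V → Action V → Player

section Play

variable {V : Type u} {G : Game V}

/-- One round in which Min plays `a` and Max plays `c`. -/
noncomputable def nextHistory (tie : TieBreak V) (h : History V) (a c : Action V) : History V :=
  if c.bid < a.bid then h.step a.move a.bid Player.min
  else if a.bid < c.bid then h.step c.move c.bid Player.max
  else match tie h a c with
    | Player.min => h.step a.move a.bid Player.min
    | Player.max => h.step c.move c.bid Player.max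

/-- The prefix, after `n` rounds, of the outcome from `v` of the Min strategy `f` and the Max
strategy `g`. -/
noncomputable def out (tie : TieBreak V) (f g : Strategy G) (v : V) : ℕ → History V
  | 0 => History.start v
  | n + 1 =>
    nextHistory tie (out tie f g v n) (f.act (out tie f g v n)) (g.act (out tie f g v n))

/-- `f` is a legal strategy for Min with initial budget `B`: he never bids more than he has. -/
def LegalMin (tie : TieBreak V) (B : ℝ) (f : Strategy G) : Prop :=
  ∀ (v : V) (g : Strategy G) (n : ℕ),
    (f.act (out tie f g v n)).bid ≤ B - (out tie f g v n).pay Player.min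

/-- `g` is a legal strategy for Max with initial budget `B`. -/
def LegalMax (tie : TieBreak V) (B : ℝ) (g : Strategy G) : Prop :=
  ∀ (v : V) (f : Strategy G) (n : ℕ),
    (g.act (out tie f g v n)).bid ≤ B - (out tie f g v n).pay Player.max

/-- The mean-payoff value of the outcome (a bounded sequence when `V` is finite). -/
noncomputable def meanPayoff (tie : TieBreak V) (f g : Strategy G) (v : V) : ℝ :=
  liminf (fun n : ℕ => ((out tie f g v n).energy G : ℝ) / (n : ℝ)) atTop

/-- From `v`, with initial budget `B` for Min and `1 - B` for Max, the Min strategy `f` is legal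
and guarantees a non-positive mean-payoff value. -/
def MinGuarantees (tie : TieBreak V) (v : V) (B : ℝ) (f : Strategy G) : Prop :=
  LegalMin tie B f ∧ ∀ g : Strategy G, LegalMax tie (1 - B) g → meanPayoff tie f g v ≤ 0

/-- From `v`, with initial budget `B` for Max and `1 - B` for Min, the Max strategy `g` is legal
and guarantees a strictly positive mean-payoff value. -/
def MaxGuarantees (tie : TieBreak V) (v : V) (B : ℝ) (g : Strategy G) : Prop :=
  LegalMax tie B g ∧ ∀ f : Strategy G, LegalMin tie (1 - B) f → 0 < meanPayoff tie f g v

/-- `t` is a threshold budget at `v`: above `t` Min can guarantee a non-positive value, and above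
`1 - t` Max can guarantee a strictly positive value. -/
def IsThreshold (G : Game V) (tie : TieBreak V) (v : V) (t : ℝ) : Prop :=
  0 ≤ t ∧ t ≤ 1 ∧
  (∀ B : ℝ, t < B → B ≤ 1 → ∃ f : Strategy G, MinGuarantees tie v B f) ∧
  (∀ B : ℝ, 1 - t < B → B ≤ 1 → ∃ g : Strategy G, MaxGuarantees tie v B g)

/-- The threshold budget at `v`, as the least `t ∈ [0,1]` above which every budget suffices for
Min. The set contains `1`. By `thresh_eq` this is the threshold budget whenever there is one in the
two-sided sense of `IsThreshold`. -/
noncomputable def thresh (G : Game V) (tie : TieBreak V) (v : V) : ℝ :=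
  sInf {t : ℝ | 0 ≤ t ∧ t ≤ 1 ∧
    ∀ B : ℝ, t < B → B ≤ 1 → ∃ f : Strategy G, MinGuarantees tie v B f}

theorem thresh_eq {tie : TieBreak V} {v : V} {t : ℝ} (h : IsThreshold G tie v t) :
    thresh G tie v = t := by
  obtain ⟨h0, h1, hmin, hmax⟩ := h
  apply IsLeast.csInf_eq
  refine ⟨⟨h0, h1, hmin⟩, ?_⟩
  rintro s ⟨hs0, hs1, hs⟩
  by_contra hst
  have hst : s < t := not_le.mp hst
  obtain ⟨B, hB1, hB2⟩ := exists_between hst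
  obtain ⟨f, hf, hfw⟩ := hs B hB1 (by linarith)
  obtain ⟨g, hg, hgw⟩ := hmax (1 - B) (by linarith) (by linarith)
  have h1 := hfw g hg
  have h2 := hgw f (by rwa [sub_sub_cancel])
  linarith

end Play

/-! ### Memoryless strategies -/

/-- A simple bid function of the current budget (variable `0`) and the current energy
(variable `1`): a selection between finitely many polynomials. The selection itself is by a list
of polynomial guards: the first case whose guard is positive applies. -/
structure SimpleBid where
  cases : List (MvPolynomial (Fin 2) ℝ × MvPolynomial (Fin 2) ℝ)
  otherwise : MvPolynomial (Fin 2) ℝ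

/-- Value of a list of guarded polynomials at the point `x`, with default polynomial `d`. -/
noncomputable def evalCases (x : Fin 2 → ℝ) (d : MvPolynomial (Fin 2) ℝ) :
    List (MvPolynomial (Fin 2) ℝ × MvPolynomial (Fin 2) ℝ) → ℝ
  | [] => MvPolynomial.eval x d
  | (q, p) :: l =>
    if 0 < MvPolynomial.eval x q then MvPolynomial.eval x p else evalCases x d l

/-- The bid at budget `β` and energy `e`. -/
noncomputable def SimpleBid.eval (s : SimpleBid) (β : ℝ) (e : ℤ) : ℝ :=
  evalCases ![β, (e : ℝ)] s.otherwise s.cases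

/-- The number of polynomials between which the bid is selected. -/
def SimpleBid.size (s : SimpleBid) : ℕ := s.cases.length + 1

/-- A simple memoryless rule: for each vertex, a pair of the vertex to proceed to upon winning and
a simple bid function. -/
structure Rule (V : Type u) where
  next : V → V
  bid : V → SimpleBid

section Memoryless

variable {V : Type u}

/-- The rule in force at a history when Min has initial budget `B`. It is `gen v β`, the rule
generated for the vertex `v` and the budget `β` that Min had at the beginning of the play or, if
later, at the last moment at which the energy turned from non-positive to positive. -/
noncomputable def currentRule (G : Game V) (B : ℝ) (gen : V → ℝ → Rule V) : History V → Rule V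
  | History.start v => gen v B
  | History.step h v b i =>
    if h.energy G ≤ 0 ∧ 0 < (h.step v b i).energy G then
      gen v (B - (h.step v b i).pay Player.min)
    else currentRule G B gen h

/-- `f` is a memoryless Min strategy for initial budget `B`: a concatenation of simple memoryless
rules, each generated for the vertex and the budget at which it starts, and each selecting between
at most `K` polynomials. A new rule starts only when the energy turns from non-positive to
positive. -/
def IsMemoryless {G : Game V} (K : ℕ) (B : ℝ) (f : Strategy G) : Prop :=
  ∃ gen : V → ℝ → Rule V,
    (∀ v β x, G.Adj x ((gen v β).next x) ∧ ((gen v β).bid x).size ≤ K) ∧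
    ∀ h : History V,
      f.act h =
        ⟨((currentRule G B gen h).bid h.cur).eval (B - h.pay Player.min) (h.energy G),
          (currentRule G B gen h).next h.cur⟩

end Memoryless

/-! ### The weighted Richman function -/

section Richman

variable {V : Type u}

def StronglyConnected (G : Game V) : Prop := ∀ x y, Relation.ReflTransGen G.Adj x y

/-- `φ(v⁺)`, the largest value of `φ` on the neighbours of `v`. -/
noncomputable def maxSucc (G : Game V) (φ : V → ℝ) (v : V) : ℝ := ⨆ x : {x // G.Adj v x}, φ x

/-- `φ(v⁻)`, the smallest value of `φ` on the neighbours of `v`. -/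
noncomputable def minSucc (G : Game V) (φ : V → ℝ) (v : V) : ℝ := ⨅ x : {x // G.Adj v x}, φ x

/-- In the graph in which `u` is split into a source `u_s` and a sink `u_t`, the edges into `u` lead
to `u_t`, whose value is `0`; so this is the value of `W` upon arrival in `x`, while `W u` stands
for the value of `u_s`. -/
noncomputable def arrive (u : V) (W : V → ℝ) : V → ℝ :=
  open Classical in fun x => if x = u then 0 else W x

/-- `W` is a weighted Richman function of `G` with respect to `u`. -/
def IsWeightedRichman (G : Game V) (u : V) (W : V → ℝ) : Prop :=
  ∀ v, W v = (maxSucc G (arrive u W) v + minSucc G (arrive u W) v) / 2 + (G.w v : ℝ)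

/-- `(W(v⁺) - W(v⁻)) / 2`, the bid at `v` before normalization. -/
noncomputable def richmanBid (G : Game V) (u : V) (W : V → ℝ) (v : V) : ℝ :=
  (maxSucc G (arrive u W) v - minSucc G (arrive u W) v) / 2

end Richman

end BidMP

/-!
Both parts rest on one computation. Let `φ` satisfy `φ x + φ (next v) + 2 * y v ≤ 2 * φ v` for all
neighbours `x` of `v`. If a player bids half the gap between the largest `φ` on the neighbours and
`φ (next v)` (`halfGap`), and moves to `next v` upon winning, then `φ`, plus the sum of the weights
`y`, plus his net payment, does not increase (`add_halfGap_le`, `le_add_halfGap`). For the weighted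
Richman function, with bids and payments scaled by `1 / N`, this is the second part.

For the first part, a certificate (`IsCertificate`) combines two such functions: `θ` with `y = 0`,
which measures budget, and `Y` with the weights of the game, which measures energy. With a budget
that exceeds `θ` by a surplus, Min bids the half gap of `θ`, plus a small multiple of the half gap
of `Y` while the energy is positive. The surplus then bounds the energy for as long as a rule is in
force, whether or not the play reaches a bottom component
(`IsCertificate.exists_minGuarantees`). Max, who needs a strictly positive value, bids
amounts proportional to his surplus instead: the loss is of second order, and less than a small
gain in the weights (`IsCertificate.exists_maxGuarantees`).

Certificates exist for both players, for `θ` and `1 - θ` (`exists_certificates`), so `θ` bounds the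
threshold budget from below. On the bottom components one solves an ergodic equation
`(max Y + min Y) / 2 + w = Y + g` with a constant `g` for each component, by vanishing discount
(`exists_ergodic`). Then `θ` is the reachability Richman function that is `0` on the components with
`g ≤ 0` and `1` on those with `g > 0`. On the other vertices, a potential that increases with the
distance along `θ`-minimizing edges absorbs arbitrary weights (`exists_isCertificate`).
-/

namespace BidMP

open Filter

/-! ### Extremal values on neighbours -/

section Succ

variable {V : Type u} [Finite V] (G : Game V) {φ ψ : V → ℝ} {v x : V}

theorem le_maxSucc (h : G.Adj v x) : φ x ≤ maxSucc G φ v :=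
  le_ciSup (f := fun y : {y // G.Adj v y} => φ y) (Set.finite_range _).bddAbove ⟨x, h⟩

theorem minSucc_le (h : G.Adj v x) : minSucc G φ v ≤ φ x :=
  ciInf_le (f := fun y : {y // G.Adj v y} => φ y) (Set.finite_range _).bddBelow ⟨x, h⟩

theorem exists_eq_maxSucc (φ : V → ℝ) (v : V) : ∃ x, G.Adj v x ∧ φ x = maxSucc G φ v := by
  obtain ⟨y, hy⟩ := G.exists_adj v
  have : Nonempty {y // G.Adj v y} := ⟨⟨y, hy⟩⟩
  obtain ⟨x, hx⟩ := exists_eq_ciSup_of_finite (f := fun y : {y // G.Adj v y} => φ y)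
  exact ⟨x, x.2, hx⟩

theorem exists_eq_minSucc (φ : V → ℝ) (v : V) : ∃ x, G.Adj v x ∧ φ x = minSucc G φ v := by
  obtain ⟨y, hy⟩ := G.exists_adj v
  have : Nonempty {y // G.Adj v y} := ⟨⟨y, hy⟩⟩
  obtain ⟨x, hx⟩ := exists_eq_ciInf_of_finite (f := fun y : {y // G.Adj v y} => φ y)
  exact ⟨x, x.2, hx⟩

theorem maxSucc_le {c : ℝ} (h : ∀ x, G.Adj v x → φ x ≤ c) : maxSucc G φ v ≤ c := by
  obtain ⟨x, hx, hx'⟩ := exists_eq_maxSucc G φ v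
  exact hx' ▸ h x hx

theorem le_minSucc {c : ℝ} (h : ∀ x, G.Adj v x → c ≤ φ x) : c ≤ minSucc G φ v := by
  obtain ⟨x, hx, hx'⟩ := exists_eq_minSucc G φ v
  exact hx' ▸ h x hx

theorem minSucc_le_maxSucc : minSucc G φ v ≤ maxSucc G φ v := by
  obtain ⟨x, hx, hx'⟩ := exists_eq_minSucc G φ v
  exact hx' ▸ le_maxSucc G hx

theorem maxSucc_mono (h : ∀ x, G.Adj v x → φ x ≤ ψ x) : maxSucc G φ v ≤ maxSucc G ψ v :=
  maxSucc_le G fun x hx => (h x hx).trans (le_maxSucc G hx)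

theorem minSucc_mono (h : ∀ x, G.Adj v x → φ x ≤ ψ x) : minSucc G φ v ≤ minSucc G ψ v :=
  le_minSucc G fun x hx => (minSucc_le G hx).trans (h x hx)

theorem maxSucc_congr_add {c : ℝ} (h : ∀ x, G.Adj v x → ψ x = φ x + c) :
    maxSucc G ψ v = maxSucc G φ v + c := by
  refine le_antisymm (maxSucc_le G fun x hx => ?_) ?_
  · rw [h x hx]; linarith [le_maxSucc G (φ := φ) hx]
  · obtain ⟨x, hx, hx'⟩ := exists_eq_maxSucc G φ v
    rw [← hx', ← h x hx]; exact le_maxSucc G hx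

theorem minSucc_congr_add {c : ℝ} (h : ∀ x, G.Adj v x → ψ x = φ x + c) :
    minSucc G ψ v = minSucc G φ v + c := by
  refine le_antisymm ?_ (le_minSucc G fun x hx => ?_)
  · obtain ⟨x, hx, hx'⟩ := exists_eq_minSucc G φ v
    rw [← hx', ← h x hx]; exact minSucc_le G hx
  · rw [h x hx]; linarith [minSucc_le G (φ := φ) hx]

theorem maxSucc_neg : maxSucc G (fun x => -φ x) v = -minSucc G φ v := by
  refine le_antisymm (maxSucc_le G fun x hx => neg_le_neg (minSucc_le G hx)) ?_
  obtain ⟨x, hx, hx'⟩ := exists_eq_minSucc G φ v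
  rw [← hx']; exact le_maxSucc G (φ := fun x => -φ x) hx

theorem minSucc_neg : minSucc G (fun x => -φ x) v = -maxSucc G φ v := by
  refine le_antisymm ?_ (le_minSucc G fun x hx => neg_le_neg (le_maxSucc G hx))
  obtain ⟨x, hx, hx'⟩ := exists_eq_maxSucc G φ v
  rw [← hx']; exact minSucc_le G (φ := fun x => -φ x) hx

/-- Half the gap between the largest value of `φ` on the neighbours of `v` and its value at
`next v`: the bid at which winning (and moving to `next v`) and losing (to the worst neighbour) are
equally good. -/
noncomputable def halfGap (G : Game V) (φ : V → ℝ) (next : V → V) (v : V) : ℝ :=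
  (maxSucc G φ v - φ (next v)) / 2

variable {next : V → V} {y : ℝ}

theorem halfGap_nonneg (h : G.Adj v (next v)) : 0 ≤ halfGap G φ next v := by
  have := le_maxSucc G (φ := φ) h
  unfold halfGap; linarith

theorem add_halfGap_le (h : ∀ x, G.Adj v x → φ x + φ (next v) + 2 * y ≤ 2 * φ v) :
    φ (next v) + y + halfGap G φ next v ≤ φ v := by
  obtain ⟨x, hx, hx'⟩ := exists_eq_maxSucc G φ v
  have := h x hx
  unfold halfGap; linarith

theorem le_add_halfGap (h : ∀ x, G.Adj v x → φ x + φ (next v) + 2 * y ≤ 2 * φ v)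
    (hx : G.Adj v x) : φ x + y - halfGap G φ next v ≤ φ v := by
  have h1 := add_halfGap_le G h
  have h2 := le_maxSucc G (φ := φ) hx
  unfold halfGap at *; linarith

end Succ

/-! ### Single rounds and bounds along a play -/

section Play

variable {V : Type u} {G : Game V} (tie : TieBreak V)

theorem nextHistory_cases (h : History V) (a c : Action V) :
    (c.bid ≤ a.bid ∧ nextHistory tie h a c = h.step a.move a.bid Player.min) ∨
      (a.bid ≤ c.bid ∧ nextHistory tie h a c = h.step c.move c.bid Player.max) := by
  unfold nextHistory
  split_ifs with h1 h2
  · exact Or.inl ⟨h1.le, rfl⟩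
  · exact Or.inr ⟨h2.le, rfl⟩
  · cases tie h a c
    · exact Or.inl ⟨not_lt.1 h2, rfl⟩
    · exact Or.inr ⟨not_lt.1 h1, rfl⟩

/-- One round of a play: either Min wins with the higher bid and makes his move, or Max does. -/
theorem out_succ_cases (f g : Strategy G) (v : V) (n : ℕ) :
    ((g.act (out tie f g v n)).bid ≤ (f.act (out tie f g v n)).bid ∧
      out tie f g v (n + 1) = (out tie f g v n).step (f.act (out tie f g v n)).move
        (f.act (out tie f g v n)).bid Player.min) ∨
    ((f.act (out tie f g v n)).bid ≤ (g.act (out tie f g v n)).bid ∧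
      out tie f g v (n + 1) = (out tie f g v n).step (g.act (out tie f g v n)).move
        (g.act (out tie f g v n)).bid Player.max) :=
  nextHistory_cases tie _ _ _

theorem pay_max (h : History V) : h.pay Player.max = -h.pay Player.min := by
  induction h with
  | start v => simp [History.pay]
  | step h v b i ih => cases i <;> simp [History.pay, ih] <;> ring

@[simp] theorem cur_step (h : History V) (v : V) (b : ℝ) (i : Player) :
    (h.step v b i).cur = v := rfl

@[simp] theorem pay_min_step_min (h : History V) (v : V) (b : ℝ) :
    (h.step v b Player.min).pay Player.min = h.pay Player.min + b := by simp [History.pay]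

@[simp] theorem pay_min_step_max (h : History V) (v : V) (b : ℝ) :
    (h.step v b Player.max).pay Player.min = h.pay Player.min - b := by
  simp [History.pay, sub_eq_add_neg]

theorem energy_out_succ (f g : Strategy G) (v : V) (n : ℕ) :
    (out tie f g v (n + 1)).energy G =
      (out tie f g v n).energy G + G.w (out tie f g v n).cur := by
  rcases out_succ_cases tie f g v n with ⟨-, h⟩ | ⟨-, h⟩ <;> rw [h] <;> rfl

/-- A Min strategy whose bid is affordable whenever it is positive is legal for every non-negative
initial budget. -/
theorem legalMin_of_bid {B : ℝ} (hB : 0 ≤ B) (f : Strategy G)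
    (hf : ∀ h, (f.act h).bid = 0 ∨ (f.act h).bid ≤ B - h.pay Player.min) : LegalMin tie B f := by
  intro v g n
  have key : ∀ n, 0 ≤ B - (out tie f g v n).pay Player.min := by
    intro n
    induction n with
    | zero => simpa [out, History.pay] using hB
    | succ n ih =>
      rcases out_succ_cases tie f g v n with ⟨-, h⟩ | ⟨-, h⟩ <;> rw [h] <;> simp only
        [pay_min_step_min, pay_min_step_max]
      · rcases hf (out tie f g v n) with h0 | h0 <;> linarith
      · linarith [(g.bid_mem (out tie f g v n)).1]
  rcases hf (out tie f g v n) with h0 | h0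
  · rw [h0]; exact key n
  · exact h0

/-- A Max strategy whose bid is affordable whenever it is positive is legal for every non-negative
initial budget. -/
theorem legalMax_of_bid {B : ℝ} (hB : 0 ≤ B) (g : Strategy G)
    (hg : ∀ h, (g.act h).bid = 0 ∨ (g.act h).bid ≤ B - h.pay Player.max) : LegalMax tie B g := by
  intro v f n
  have key : ∀ n, 0 ≤ B - (out tie f g v n).pay Player.max := by
    intro n
    induction n with
    | zero => simpa [out, History.pay] using hB
    | succ n ih =>
      have hgn := hg (out tie f g v n)
      rw [pay_max] at ih hgn
      rcases out_succ_cases tie f g v n with ⟨-, h⟩ | ⟨-, h⟩ <;> rw [h] <;> simp only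
        [pay_max, pay_min_step_min, pay_min_step_max]
      · linarith [(f.bid_mem (out tie f g v n)).1]
      · rcases hgn with h0 | h0 <;> linarith
  rcases hg (out tie f g v n) with h0 | h0
  · rw [h0]; exact key n
  · exact h0

/-- While Max plays legally, Min's budget never exceeds `1`. -/
theorem budget_le_one {B : ℝ} {g : Strategy G} (hg : LegalMax tie (1 - B) g) (f : Strategy G)
    (v : V) (n : ℕ) : B - (out tie f g v n).pay Player.min ≤ 1 := by
  have h1 := hg v f n
  have h2 := (g.bid_mem (out tie f g v n)).1
  rw [pay_max] at h1
  linarith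

variable [Finite V]

theorem exists_abs_le (φ : V → ℝ) : ∃ C, 0 ≤ C ∧ ∀ v, |φ v| ≤ C := by
  obtain ⟨C, hC⟩ := (Set.finite_range fun v => |φ v|).bddAbove
  exact ⟨max C 0, le_max_right _ _, fun v => (hC ⟨v, rfl⟩).trans (le_max_left _ _)⟩

theorem exists_abs_energy_le (f g : Strategy G) (v : V) :
    ∃ C : ℝ, ∀ n : ℕ, |((out tie f g v n).energy G : ℝ)| ≤ C * n := by
  obtain ⟨C, -, hC⟩ := exists_abs_le fun x => (G.w x : ℝ)
  refine ⟨C, fun n => ?_⟩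
  induction n with
  | zero => simp [out, History.energy]
  | succ n ih =>
    rw [energy_out_succ]
    push_cast
    have := abs_add_le ((out tie f g v n).energy G : ℝ) (G.w (out tie f g v n).cur : ℝ)
    linarith [hC (out tie f g v n).cur]

theorem exists_abs_mean_le (f g : Strategy G) (v : V) :
    ∃ C : ℝ, ∀ n : ℕ, |((out tie f g v n).energy G : ℝ) / n| ≤ C := by
  obtain ⟨C, hC⟩ := exists_abs_energy_le tie f g v
  refine ⟨max C 0, fun n => ?_⟩
  rcases Nat.eq_zero_or_pos n with rfl | hn
  · simp
  · rw [abs_div, Nat.abs_cast, div_le_iff₀ (by exact_mod_cast hn)]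
    exact (hC n).trans (by gcongr; exact le_max_left _ _)

theorem meanPayoff_nonpos_of_frequently {f g : Strategy G} {v : V}
    (h : ∃ᶠ n in atTop, (out tie f g v n).energy G ≤ 0) : meanPayoff tie f g v ≤ 0 := by
  obtain ⟨C, hC⟩ := exists_abs_mean_le tie f g v
  refine liminf_le_of_frequently_le (h.mono fun n hn => ?_)
    ⟨-C, eventually_map.2 (Eventually.of_forall fun n => neg_le_of_abs_le (hC n))⟩
  exact div_nonpos_of_nonpos_of_nonneg (by exact_mod_cast hn) n.cast_nonneg

theorem meanPayoff_nonpos_of_eventually_le {f g : Strategy G} {v : V} {M : ℝ}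
    (h : ∀ᶠ n in atTop, ((out tie f g v n).energy G : ℝ) ≤ M) : meanPayoff tie f g v ≤ 0 := by
  obtain ⟨C, hC⟩ := exists_abs_mean_le tie f g v
  have hlim : Tendsto (fun n : ℕ => M / (n : ℝ)) atTop (nhds 0) :=
    tendsto_const_div_atTop_nhds_zero_nat M
  rw [← hlim.liminf_eq]
  refine liminf_le_liminf (h.mono fun n hn => ?_)
    ⟨-C, eventually_map.2 (Eventually.of_forall fun n => neg_le_of_abs_le (hC n))⟩
    hlim.isCoboundedUnder_ge
  exact div_le_div_of_nonneg_right hn n.cast_nonneg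

theorem le_meanPayoff_of_le {f g : Strategy G} {v : V} {δ M : ℝ}
    (h : ∀ n : ℕ, δ * n - M ≤ ((out tie f g v n).energy G : ℝ)) : δ ≤ meanPayoff tie f g v := by
  obtain ⟨C, hC⟩ := exists_abs_mean_le tie f g v
  have hlim : Tendsto (fun n : ℕ => δ - M / (n : ℝ)) atTop (nhds δ) := by
    simpa using (tendsto_const_div_atTop_nhds_zero_nat M).const_sub δ
  rw [← hlim.liminf_eq]
  refine liminf_le_liminf ?_ hlim.isBoundedUnder_ge ?_
  · filter_upwards [eventually_gt_atTop 0] with n hn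
    have hn' : (0 : ℝ) < n := by exact_mod_cast hn
    rw [le_div_iff₀ hn', sub_mul, div_mul_cancel₀ _ hn'.ne']
    exact h n
  · exact IsBoundedUnder.isCoboundedUnder_ge
      ⟨C, eventually_map.2 (Eventually.of_forall fun n => le_of_abs_le (hC n))⟩

end Play

/-! ### Certificates and the memoryless strategy of Min -/


section Certificate

variable {V : Type u}

/-- A certificate that a player wins from `v` with every budget above `θ v`, in the game in which
he wants the sum of the weights `y` not to drift upwards. He moves along `next`. The function `θ`
is a supersolution of the Richman equation for budgets, and `Y` a supersolution of the Richman
equation with weights `y` wherever a budget above `θ` is possible at all. -/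
structure IsCertificate (G : Game V) (y θ Y : V → ℝ) (next : V → V) : Prop where
  adj : ∀ v, G.Adj v (next v)
  nonneg : ∀ v, 0 ≤ θ v
  le_one : ∀ v, θ v ≤ 1
  threshold : ∀ v x, G.Adj v x → θ x + θ (next v) ≤ 2 * θ v
  potential : ∀ v x, θ v < 1 → G.Adj v x → Y x + Y (next v) + 2 * y v ≤ 2 * Y v

variable {G : Game V} {y θ Y : V → ℝ} {next : V → V}

namespace IsCertificate

variable [Finite V]

theorem theta_win (hc : IsCertificate G y θ Y next) (v : V) :
    θ (next v) + halfGap G θ next v ≤ θ v := by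
  have := add_halfGap_le G (φ := θ) (next := next) (v := v) (y := 0)
    (by simpa using hc.threshold v)
  linarith

theorem theta_lose (hc : IsCertificate G y θ Y next) {v x : V} (hx : G.Adj v x) :
    θ x - halfGap G θ next v ≤ θ v := by
  have := le_add_halfGap G (φ := θ) (next := next) (v := v) (y := 0)
    (by simpa using hc.threshold v) hx
  linarith

theorem halfGap_le (hc : IsCertificate G y θ Y next) (v : V) : halfGap G θ next v ≤ θ v := by
  linarith [hc.theta_win v, hc.nonneg (next v)]

theorem potential_win (hc : IsCertificate G y θ Y next) {v : V} (hv : θ v < 1) :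
    Y (next v) + y v + halfGap G Y next v ≤ Y v :=
  add_halfGap_le G fun x hx => hc.potential v x hv hx

theorem potential_lose (hc : IsCertificate G y θ Y next) {v x : V} (hv : θ v < 1) (hx : G.Adj v x) :
    Y x + y v - halfGap G Y next v ≤ Y v :=
  le_add_halfGap G (fun x hx => hc.potential v x hv hx) hx

end IsCertificate

/-- The bid `halfGap θ + κ * halfGap Y` at `x`, where `κ = (β - θ v) / Q`, cut off to `[0,1]`. -/
noncomputable def cutBid (G : Game V) (θ Y : V → ℝ) (next : V → V) (Q : ℝ) (v : V) (β : ℝ)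
    (x : V) : ℝ :=
  max 0 (min 1 (halfGap G θ next x + (β - θ v) / Q * halfGap G Y next x))

open MvPolynomial in
/-- Min's rule, generated for the vertex `v` and the budget `β`. At non-positive energy it keeps
the surplus of the budget over `θ`; at positive energy it invests the proportion `(β - θ v) / Q` of
the energy differences measured by `Y`. An unaffordable bid is replaced by `0`. -/
noncomputable def minRule (G : Game V) (θ Y : V → ℝ) (next : V → V) (Q : ℝ) (v : V) (β : ℝ) :
    Rule V where
  next := next
  bid x :=
    { cases := [(C (halfGap G θ next x) - X 0, 0), (1 - X 1, C (halfGap G θ next x)),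
        (C (cutBid G θ Y next Q v β x) - X 0, 0)]
      otherwise := C (cutBid G θ Y next Q v β x) }

theorem eval_minRule (Q : ℝ) (v : V) (β : ℝ) (x : V) (b : ℝ) (e : ℤ) :
    ((minRule G θ Y next Q v β).bid x).eval b e =
      if b < halfGap G θ next x then 0 else if e ≤ 0 then halfGap G θ next x
      else if b < cutBid G θ Y next Q v β x then 0 else cutBid G θ Y next Q v β x := by
  have he : (0 : ℝ) < 1 - (e : ℝ) ↔ e ≤ 0 := by
    rw [sub_pos]
    exact_mod_cast Int.lt_add_one_iff (a := e) (b := 0)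
  simp [minRule, SimpleBid.eval, evalCases, he, -sub_pos]
  simp

/-- The vertex and Min's budget at the moment at which the rule in force was started. -/
noncomputable def ruleStart (G : Game V) (B : ℝ) : History V → V × ℝ
  | History.start v => (v, B)
  | History.step h v b i =>
    if h.energy G ≤ 0 ∧ 0 < (h.step v b i).energy G then
      (v, B - (h.step v b i).pay Player.min)
    else ruleStart G B h

theorem currentRule_eq (B : ℝ) (gen : V → ℝ → Rule V) (h : History V) :
    currentRule G B gen h = gen (ruleStart G B h).1 (ruleStart G B h).2 := by
  induction h with
  | start v => rfl
  | step h v b i ih =>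
    simp only [currentRule, ruleStart]
    split_ifs
    · rfl
    · exact ih

variable [Finite V]

/-- The strategy that concatenates the rules `minRule`. -/
noncomputable def IsCertificate.minStrategy (hc : IsCertificate G y θ Y next) (Q B : ℝ) :
    Strategy G where
  act h :=
    ⟨((currentRule G B (minRule G θ Y next Q) h).bid h.cur).eval (B - h.pay Player.min)
      (h.energy G), (currentRule G B (minRule G θ Y next Q) h).next h.cur⟩
  bid_mem h := by
    rw [currentRule_eq, eval_minRule]
    have h0 := halfGap_nonneg G (φ := θ) (hc.adj h.cur)
    have h1 := (hc.halfGap_le h.cur).trans (hc.le_one _)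
    split_ifs
    · simp
    · exact ⟨h0, h1⟩
    · simp
    · exact ⟨le_max_left _ _, max_le zero_le_one (min_le_left _ _)⟩
  move_adj h := by
    rw [currentRule_eq]
    exact hc.adj _

theorem IsCertificate.minStrategy_bid (hc : IsCertificate G y θ Y next)
    (Q B : ℝ) (h : History V) :
    ((hc.minStrategy Q B).act h).bid =
      if B - h.pay Player.min < halfGap G θ next h.cur then 0
      else if h.energy G ≤ 0 then halfGap G θ next h.cur
      else if B - h.pay Player.min <
          cutBid G θ Y next Q (ruleStart G B h).1 (ruleStart G B h).2 h.cur then 0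
        else cutBid G θ Y next Q (ruleStart G B h).1 (ruleStart G B h).2 h.cur := by
  simp only [IsCertificate.minStrategy, currentRule_eq, eval_minRule]

theorem IsCertificate.minStrategy_move (hc : IsCertificate G y θ Y next)
    (Q B : ℝ) (h : History V) :
    ((hc.minStrategy Q B).act h).move = next h.cur := by
  simp only [IsCertificate.minStrategy, currentRule_eq, minRule]

theorem IsCertificate.isMemoryless_minStrategy (hc : IsCertificate G y θ Y next)
    (Q B : ℝ) :
    IsMemoryless 4 B (hc.minStrategy Q B) :=
  ⟨minRule G θ Y next Q, fun _ _ x => ⟨hc.adj x, by simp [minRule, SimpleBid.size]⟩, fun _ => rfl⟩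

theorem IsCertificate.legalMin_minStrategy (hc : IsCertificate G y θ Y next)
    (tie : TieBreak V) (Q : ℝ) {B : ℝ} (hB : 0 ≤ B) :
    LegalMin tie B (hc.minStrategy Q B) := by
  refine legalMin_of_bid tie hB _ fun h => ?_
  rw [hc.minStrategy_bid]
  split_ifs with h1 h2 h3
  · exact Or.inl rfl
  · exact Or.inr (not_lt.1 h1)
  · exact Or.inl rfl
  · exact Or.inr (not_lt.1 h3)

/-- A Min strategy that at each vertex bids the half gap of `θ` plus `r`, and moves along `next`,
loses at most `r` of his surplus over `θ` by winning and gains at least `r` by losing. -/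
theorem IsCertificate.surplus_cases (hc : IsCertificate G y θ Y next) (tie : TieBreak V)
    {f g : Strategy G} {v : V} {n : ℕ} {B r : ℝ}
    (hbid : (f.act (out tie f g v n)).bid = halfGap G θ next (out tie f g v n).cur + r)
    (hmove : (f.act (out tie f g v n)).move = next (out tie f g v n).cur) :
    ((out tie f g v (n + 1)).cur = next (out tie f g v n).cur ∧
      B - (out tie f g v n).pay Player.min - θ (out tie f g v n).cur - r ≤
        B - (out tie f g v (n + 1)).pay Player.min - θ (out tie f g v (n + 1)).cur) ∨
    (G.Adj (out tie f g v n).cur (out tie f g v (n + 1)).cur ∧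
      B - (out tie f g v n).pay Player.min - θ (out tie f g v n).cur + r ≤
        B - (out tie f g v (n + 1)).pay Player.min - θ (out tie f g v (n + 1)).cur) := by
  rcases out_succ_cases tie f g v n with ⟨-, h⟩ | ⟨hle, h⟩
  · left
    rw [h, hmove, hbid]
    refine ⟨rfl, ?_⟩
    simp only [pay_min_step_min, cur_step]
    linarith [hc.theta_win (out tie f g v n).cur]
  · right
    rw [h]
    have hadj := g.move_adj (out tie f g v n)
    refine ⟨hadj, ?_⟩
    simp only [pay_min_step_max, cur_step]
    linarith [hc.theta_lose hadj]

end Certificate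

section MinWins

variable {V : Type u} [Finite V] {G : Game V} {θ Y : V → ℝ} {next : V → V}

/-- A certificate for the weights of the game gives Min a memoryless winning strategy. While the
energy is positive, `κ * (energy + Y) - surplus` does not increase, where the factor `κ` of the
rule in force is so small that the surplus is at least `κ * (energy + cM + 1)` all the time. So
bids are affordable, the energy is at most `κ⁻¹` while a rule is in force, and a positive surplus
remains for the next rule. -/
theorem IsCertificate.exists_minGuarantees (hc : IsCertificate G (fun v => (G.w v : ℝ)) θ Y next)
    (tie : TieBreak V) {v : V} {B : ℝ} (hB : θ v < B) :
    ∃ f : Strategy G, IsMemoryless 4 B f ∧ MinGuarantees tie v B f := by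
  obtain ⟨wM, hwM0, hwM⟩ := exists_abs_le fun x => (G.w x : ℝ)
  obtain ⟨YM, hYM0, hYM⟩ := exists_abs_le Y
  obtain ⟨cM, hcM0, hcM⟩ := exists_abs_le (halfGap G Y next)
  set Q := 1 + cM + 2 * YM + wM with hQ
  have hQ0 : 0 < Q := by positivity
  refine ⟨hc.minStrategy Q B, hc.isMemoryless_minStrategy Q B,
    hc.legalMin_minStrategy tie Q ((hc.nonneg v).trans hB.le), fun g hg => ?_⟩
  set f := hc.minStrategy Q B with hf
  set H := out tie f g v with hH
  set s : ℕ → ℝ := fun n => B - (H n).pay Player.min - θ (H n).cur with hs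
  set κ : ℕ → ℝ := fun n => ((ruleStart G B (H n)).2 - θ (ruleStart G B (H n)).1) / Q with hκ
  have hβ : ∀ n, B - (H n).pay Player.min ≤ 1 := budget_le_one tie hg f v
  have hw : ∀ x, (G.w x : ℝ) ≤ wM := fun x => le_of_abs_le (hwM x)
  have hY : ∀ x, Y x ≤ YM := fun x => le_of_abs_le (hYM x)
  have hY' : ∀ x, -YM ≤ Y x := fun x => neg_le_of_abs_le (hYM x)
  have hcc : ∀ x, halfGap G Y next x ≤ cM := fun x => le_of_abs_le (hcM x)
  have hc0 : ∀ x, 0 ≤ halfGap G Y next x := fun x => halfGap_nonneg G (hc.adj x)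
  have ha0 : ∀ x, 0 ≤ halfGap G θ next x := fun x => halfGap_nonneg G (hc.adj x)
  have hmove : ∀ n, (f.act (H n)).move = next (H n).cur := fun n => hc.minStrategy_move Q B _
  have hE : ∀ n, (H (n + 1)).energy G = (H n).energy G + G.w (H n).cur :=
    energy_out_succ tie f g v
  have hstart : ∀ n, ruleStart G B (H (n + 1)) =
      if (H n).energy G ≤ 0 ∧ 0 < (H (n + 1)).energy G then
        ((H (n + 1)).cur, B - (H (n + 1)).pay Player.min) else ruleStart G B (H n) := by
    intro n
    rcases out_succ_cases tie f g v n with ⟨-, h⟩ | ⟨-, h⟩ <;> simp only [hH] <;> rw [h] <;> rfl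
  -- the surplus suffices to support positive energy
  have hsupp : ∀ n, 0 < κ n →
      κ n * ((H n).energy G + Y (H n).cur + Q - wM - YM) ≤ s n →
      κ n * ((H n).energy G + cM + 1) ≤ s n := by
    intro n hκn h
    refine le_trans (mul_le_mul_of_nonneg_left ?_ hκn.le) h
    have := hY' (H n).cur
    rw [hQ]; linarith
  have inv : ∀ n, 0 < s n ∧ 0 < κ n ∧ (0 < (H n).energy G →
      κ n * ((H n).energy G + Y (H n).cur + Q - wM - YM) ≤ s n) := by
    intro n
    induction n with
    | zero =>
      have h0 : 0 < B - θ v := sub_pos.2 hB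
      refine ⟨by simpa [hs, hH, out, History.pay, History.cur] using hB, ?_, ?_⟩
      · simpa [hκ, hH, out, ruleStart] using div_pos h0 hQ0
      · simp [hH, out, History.energy]
    | succ n ih =>
      obtain ⟨hsn, hκn, hen⟩ := ih
      have hβn := hβ n
      have hθ1 : θ (H n).cur < 1 := by simp only [hs] at hsn; linarith
      have hale : halfGap G θ next (H n).cur ≤ B - (H n).pay Player.min := by
        have := hc.halfGap_le (H n).cur
        simp only [hs] at hsn; linarith
      by_cases he : (H n).energy G ≤ 0
      · -- at non-positive energy, the bid preserves the surplus
        have hbid : (f.act (H n)).bid = halfGap G θ next (H n).cur + 0 := by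
          rw [hf, hc.minStrategy_bid, if_neg (not_lt.2 hale), if_pos he, add_zero]
        have hs' : s n ≤ s (n + 1) := by
          rcases hc.surplus_cases tie (B := B) hbid (hmove n) with ⟨-, h⟩ | ⟨-, h⟩ <;>
          · simp only [hs]; linarith
        have hs1 := hsn.trans_le hs'
        refine ⟨hs1, ?_, fun he' => ?_⟩
        · simp only [hκ, hstart]
          split_ifs
          · exact div_pos hs1 hQ0
          · exact hκn
        · have hκ' : κ (n + 1) * Q = s (n + 1) := by
            simp only [hκ, hstart]
            rw [if_pos ⟨he, he'⟩, div_mul_cancel₀ _ hQ0.ne']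
          have hκp : 0 < κ (n + 1) := by
            by_contra hneg
            linarith [mul_nonpos_of_nonpos_of_nonneg (not_lt.1 hneg) hQ0.le]
          rw [← hκ']
          refine mul_le_mul_of_nonneg_left ?_ hκp.le
          have h1 := hY (H (n + 1)).cur
          have h2 := hw (H n).cur
          have h3 : ((H n).energy G : ℝ) ≤ 0 := by exact_mod_cast he
          rw [hE]; push_cast; linarith
      · have he1 : 0 < (H n).energy G := not_le.1 he
        have he1' : (1 : ℝ) ≤ (H n).energy G := by exact_mod_cast he1
        have hκ' : κ (n + 1) = κ n := by
          simp only [hκ, hstart]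
          rw [if_neg fun h => he h.1]
        have hpot := hen he1
        have hsup := hsupp n hκn hpot
        set r := κ n * halfGap G Y next (H n).cur with hr
        have hr0 : 0 ≤ r := mul_nonneg hκn.le (hc0 _)
        have hrs : r + κ n ≤ s n := by
          refine le_trans ?_ hsup
          rw [hr]
          nlinarith [hcc (H n).cur]
        have hcut : cutBid G θ Y next Q (ruleStart G B (H n)).1 (ruleStart G B (H n)).2 (H n).cur =
            halfGap G θ next (H n).cur + r := by
          have h1 : halfGap G θ next (H n).cur + r ≤ 1 := by
            have := hc.halfGap_le (H n).cur
            simp only [hs] at hrs; linarith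
          change max 0 (min 1 (halfGap G θ next (H n).cur + r)) = _
          rw [min_eq_right h1, max_eq_right (add_nonneg (ha0 _) hr0)]
        have hbid : (f.act (H n)).bid = halfGap G θ next (H n).cur + r := by
          rw [hf, hc.minStrategy_bid, if_neg (not_lt.2 hale), if_neg he, hcut, if_neg]
          have := hc.halfGap_le (H n).cur
          simp only [hs] at hrs
          rw [not_lt]
          linarith
        have key : s n - r ≤ s (n + 1) ∧
            κ n * ((H (n + 1)).energy G + Y (H (n + 1)).cur + Q - wM - YM) ≤ s (n + 1) := by
          rw [hE]; push_cast
          rcases hc.surplus_cases tie (B := B) hbid (hmove n) with ⟨hcur, h⟩ | ⟨hadj, h⟩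
          · have hp := hc.potential_win hθ1
            have h' : s n - r ≤ s (n + 1) := by simp only [hs]; linarith
            refine ⟨h', ?_⟩
            change (H (n + 1)).cur = _ at hcur
            rw [hcur]
            have := mul_le_mul_of_nonneg_left hp hκn.le
            linarith
          · have hp := hc.potential_lose hθ1 hadj
            have h' : s n + r ≤ s (n + 1) := by simp only [hs]; linarith
            refine ⟨by linarith, ?_⟩
            have := mul_le_mul_of_nonneg_left hp hκn.le
            change κ n * (Y (H (n + 1)).cur + _ - _) ≤ _ at this
            linarith
        exact ⟨by linarith [key.1], hκ' ▸ hκn, fun _ => hκ' ▸ key.2⟩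
  by_cases hfreq : ∃ᶠ n in atTop, (H n).energy G ≤ 0
  · exact meanPayoff_nonpos_of_frequently tie hfreq
  · obtain ⟨n₀, hn₀⟩ := eventually_atTop.1 (not_frequently.1 hfreq)
    have hconst : ∀ n, n₀ ≤ n → κ n = κ n₀ := by
      intro n hn
      induction n, hn using Nat.le_induction with
      | base => rfl
      | succ n hn ih =>
        rw [← ih]
        simp only [hκ, hstart]
        rw [if_neg fun h => hn₀ n hn h.1]
    refine meanPayoff_nonpos_of_eventually_le tie (M := 1 / κ n₀) (eventually_atTop.2 ⟨n₀, ?_⟩)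
    intro n hn
    obtain ⟨-, hκn, hen⟩ := inv n
    have h1 := hsupp n hκn (hen (not_le.1 (hn₀ n hn)))
    rw [hconst n hn] at h1 hκn
    rw [le_div_iff₀ hκn]
    have h2 := hβ n
    have h3 := hc.nonneg (H n).cur
    simp only [hs] at h1
    change ((H n).energy G : ℝ) * _ ≤ _
    nlinarith

end MinWins

/-! ### Max's strategy with proportional bids -/

section MaxWins

variable {V : Type u} {G : Game V} {y θ Y : V → ℝ} {next : V → V}

open Classical in
/-- Max's strategy: his surplus `s` is his budget minus `θ`, and he bids the half gap of `θ` plus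
the proportion `α * halfGap Y` of `s` (or `0` if this is unaffordable). -/
noncomputable def IsCertificate.maxStrategy (hc : IsCertificate G y θ Y next) (α B : ℝ) :
    Strategy G where
  act h :=
    let p := max 0 (min 1 (halfGap G θ next h.cur +
      α * halfGap G Y next h.cur * (B - h.pay Player.max - θ h.cur)))
    ⟨if p ≤ B - h.pay Player.max then p else 0, next h.cur⟩
  bid_mem h := by
    dsimp only
    split_ifs
    · exact ⟨le_max_left _ _, max_le zero_le_one (min_le_left _ _)⟩
    · simp
  move_adj _ := hc.adj _

theorem IsCertificate.legalMax_maxStrategy (hc : IsCertificate G y θ Y next) (tie : TieBreak V)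
    (α : ℝ) {B : ℝ} (hB : 0 ≤ B) : LegalMax tie B (hc.maxStrategy α B) := by
  refine legalMax_of_bid tie hB _ fun h => ?_
  simp only [IsCertificate.maxStrategy]
  split_ifs with h1
  · exact Or.inr h1
  · exact Or.inl rfl

theorem neg_sub_le_log_one_sub {x : ℝ} (h1 : x ≤ 1 / 2) :
    -x - 2 * x ^ 2 ≤ Real.log (1 - x) := by
  have hx : 0 < 1 - x := by linarith
  refine le_trans ?_ (Real.one_sub_inv_le_log_of_pos hx)
  rw [le_sub_iff_add_le, ← le_sub_iff_add_le', inv_le_iff_one_le_mul₀ hx]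
  nlinarith [mul_nonneg (sq_nonneg x) (sub_nonneg.2 h1)]

theorem sub_le_log_one_add {x : ℝ} (h0 : 0 ≤ x) : x - 2 * x ^ 2 ≤ Real.log (1 + x) := by
  have hx : 0 < 1 + x := by linarith
  refine le_trans ?_ (Real.one_sub_inv_le_log_of_pos hx)
  rw [le_sub_iff_add_le, ← le_sub_iff_add_le', inv_le_iff_one_le_mul₀ hx]
  nlinarith [mul_nonneg (sq_nonneg x) h0, sq_nonneg x]

variable [Finite V]

/-- A certificate for the weights `ε - w` lets Max push the mean payoff up to `ε / 2`. As his bids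
are proportional to his surplus `s`, they are always affordable; and
`α * (ε * n - energy + Y) - log s` grows in a round by a quadratic term in `α` at most, which for
small `α` is half of what the `ε` contributes. Since `s ≤ 1`, the energy grows linearly. -/
theorem IsCertificate.exists_maxGuarantees {ε : ℝ} (hε : 0 < ε)
    (hc : IsCertificate G (fun v => ε - G.w v) θ Y next) (tie : TieBreak V) {v : V} {B : ℝ}
    (hB : θ v < B) : ∃ g : Strategy G, MaxGuarantees tie v B g := by
  obtain ⟨YM, hYM0, hYM⟩ := exists_abs_le Y
  obtain ⟨cM, hcM1, hcM⟩ : ∃ C, 1 ≤ C ∧ ∀ v, |halfGap G Y next v| ≤ C := by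
    obtain ⟨C, -, hC⟩ := exists_abs_le (halfGap G Y next)
    exact ⟨max C 1, le_max_right _ _, fun v => (hC v).trans (le_max_left _ _)⟩
  set α := min ε 1 / (4 * cM ^ 2) with hα
  have hα0 : 0 < α := by positivity
  have hαc : 4 * (α * cM) * cM ≤ ε ∧ 4 * (α * cM) * cM ≤ 1 := by
    have : 4 * (α * cM) * cM = min ε 1 := by rw [hα]; field_simp
    exact this ▸ ⟨min_le_left _ _, min_le_right _ _⟩
  have hαc2 : α * cM ≤ 1 / 2 := by
    have := mul_pos hα0 (lt_of_lt_of_le one_pos hcM1)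
    nlinarith [hαc.2]
  refine ⟨hc.maxStrategy α B, hc.legalMax_maxStrategy tie α ((hc.nonneg v).trans hB.le),
    fun f hf => ?_⟩
  set g := hc.maxStrategy α B with hg
  set H := out tie f g v with hH
  set s : ℕ → ℝ := fun n => B + (H n).pay Player.min - θ (H n).cur with hs
  have hβ : ∀ n, B + (H n).pay Player.min ≤ 1 := by
    intro n
    have h1 := hf v g n
    have h2 := (f.bid_mem (H n)).1
    change (f.act (H n)).bid ≤ 1 - B - (H n).pay Player.min at h1
    linarith
  have hE : ∀ n, (H (n + 1)).energy G = (H n).energy G + G.w (H n).cur :=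
    energy_out_succ tie f g v
  set L : ℕ → ℝ := fun n =>
    α * (ε * n - (H n).energy G + Y (H n).cur) - Real.log (s n) with hL
  have inv : ∀ n, 0 < s n ∧ L n ≤ L 0 + α * (ε / 2) * n := by
    intro n
    induction n with
    | zero => exact ⟨by simpa [hs, hH, out, History.pay, History.cur] using hB, by simp⟩
    | succ n ih =>
      obtain ⟨hsn, hLn⟩ := ih
      have hβn := hβ n
      have hθ1 : θ (H n).cur < 1 := by simp only [hs] at hsn; linarith
      have hc0 := halfGap_nonneg G (φ := Y) (hc.adj (H n).cur)
      have ha0 := halfGap_nonneg G (φ := θ) (hc.adj (H n).cur)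
      have haθ := hc.halfGap_le (H n).cur
      set x := α * halfGap G Y next (H n).cur with hx
      have hx0 : 0 ≤ x := mul_nonneg hα0.le hc0
      have hxc : x ≤ α * cM := mul_le_mul_of_nonneg_left (le_of_abs_le (hcM _)) hα0.le
      have hx1 : x ≤ 1 / 2 := hxc.trans hαc2
      have hx2 : 2 * x ^ 2 ≤ α * (ε / 2) := by nlinarith [hαc.1]
      have hxs0 : 0 ≤ x * s n := mul_nonneg hx0 hsn.le
      have hxs1 : x * s n ≤ s n := by nlinarith
      have hbid : (g.act (H n)).bid = halfGap G θ next (H n).cur + x * s n := by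
        have hsum : halfGap G θ next (H n).cur + x * s n ≤ B + (H n).pay Player.min := by
          simp only [hs] at hxs1 ⊢; linarith
        simp only [hg, IsCertificate.maxStrategy, pay_max, sub_neg_eq_add]
        change (if max 0 (min 1 (halfGap G θ next (H n).cur + x * s n)) ≤ _ then _ else _) = _
        rw [min_eq_right (hsum.trans hβn), max_eq_right (add_nonneg ha0 hxs0), if_pos hsum]
      have key : 0 < s (n + 1) ∧ Real.log (s n) + α * (ε - G.w (H n).cur + Y (H (n + 1)).cur -
          Y (H n).cur) - 2 * x ^ 2 ≤ Real.log (s (n + 1)) := by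
        rcases out_succ_cases tie f g v n with ⟨hle, h⟩ | ⟨-, h⟩
        · have hadj := f.move_adj (H n)
          have hs' : s n * (1 + x) ≤ s (n + 1) := by
            have := hc.theta_lose hadj
            change (g.act (H n)).bid ≤ (f.act (H n)).bid at hle
            rw [hbid] at hle
            simp only [hs, hH] at hle this ⊢
            rw [h, pay_min_step_min, cur_step]
            linarith
          have hcur : (H (n + 1)).cur = (f.act (H n)).move := by simp only [hH]; rw [h, cur_step]
          have hp := mul_le_mul_of_nonneg_left (hc.potential_lose hθ1 hadj) hα0.le
          have h1 : 0 < s n * (1 + x) := by positivity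
          refine ⟨h1.trans_le hs', ?_⟩
          have h2 := Real.log_le_log h1 hs'
          rw [Real.log_mul hsn.ne' (by positivity)] at h2
          have h3 := sub_le_log_one_add hx0
          rw [hcur]
          linarith
        · have hs' : s n * (1 - x) ≤ s (n + 1) := by
            have := hc.theta_win (H n).cur
            simp only [hs, hH] at hbid this ⊢
            rw [h, pay_min_step_max, cur_step, hbid]
            change _ ≤ _ - θ (next _)
            linarith
          have hcur : (H (n + 1)).cur = next (H n).cur := by
            simp only [hH]; rw [h, cur_step]; rfl
          have hp := mul_le_mul_of_nonneg_left (hc.potential_win hθ1) hα0.le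
          have h1 : 0 < s n * (1 - x) := mul_pos hsn (by linarith)
          refine ⟨h1.trans_le hs', ?_⟩
          have h2 := Real.log_le_log h1 hs'
          rw [Real.log_mul hsn.ne' (by linarith)] at h2
          have h3 := neg_sub_le_log_one_sub hx1
          rw [hcur]
          linarith
      refine ⟨key.1, ?_⟩
      simp only [hL] at hLn ⊢
      rw [hE]
      push_cast
      linarith [key.2]
  refine lt_of_lt_of_le (half_pos hε) (le_meanPayoff_of_le tie (M := L 0 / α + YM) fun n => ?_)
  obtain ⟨hsn, hLn⟩ := inv n
  have hs1 : Real.log (s n) ≤ 0 := by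
    refine Real.log_nonpos hsn.le ?_
    have h1 := hβ n
    have h2 := hc.nonneg (H n).cur
    simp only [hs]; linarith
  have hY := neg_le_of_abs_le (hYM (H n).cur)
  have h1 : α * (ε * n - (H n).energy G + Y (H n).cur) ≤ α * (L 0 / α + ε / 2 * n) := by
    rw [mul_add α (L 0 / α), mul_div_cancel₀ _ hα0.ne']
    change α * _ - _ ≤ _ at hLn
    linarith
  have h2 := le_of_mul_le_mul_left h1 hα0
  change _ ≤ ((H n).energy G : ℝ)
  linarith

end MaxWins

/-! ### Richman functions of strongly connected games -/

section Richman

variable {V : Type u} [Finite V] {G : Game V} {u : V} {W : V → ℝ} {next : V → V}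

theorem richmanBid_nonneg (v : V) : 0 ≤ richmanBid G u W v := by
  have := minSucc_le_maxSucc G (φ := arrive u W) (v := v)
  unfold richmanBid; linarith

theorem IsWeightedRichman.le_arrive (hW : IsWeightedRichman G u W) (hu : W u ≤ 0) (v x : V)
    (hx : G.Adj v x) :
    arrive u W x + minSucc G (arrive u W) v + 2 * G.w v ≤ 2 * arrive u W v := by
  have h1 := le_maxSucc G (φ := arrive u W) hx
  have h2 : W v ≤ arrive u W v := by
    unfold arrive
    split_ifs with h
    · exact h ▸ hu
    · exact le_rfl
  linarith [hW v]

/-- The strategy that bids `richmanBid / N` and moves along `next`. -/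
noncomputable def richmanStrategy (G : Game V) (u : V) (W : V → ℝ) (next : V → V)
    (hnext : ∀ v, G.Adj v (next v)) {N : ℕ} (hN : ∀ v, richmanBid G u W v / N ≤ 1) :
    Strategy G where
  act h := ⟨richmanBid G u W h.cur / N, next h.cur⟩
  bid_mem _ := ⟨div_nonneg (richmanBid_nonneg _) N.cast_nonneg, hN _⟩
  move_adj _ := hnext _

theorem energy_add_pay_le (tie : TieBreak V) (hW : IsWeightedRichman G u W) (hu : W u ≤ 0)
    (hnext : ∀ v, G.Adj v (next v) ∧ arrive u W (next v) = minSucc G (arrive u W) v)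
    {N : ℕ} (hN0 : 0 < N) {f : Strategy G}
    (hf : ∀ h : History V, f.act h = ⟨richmanBid G u W h.cur / (N : ℝ), next h.cur⟩)
    (g : Strategy G) (v : V) (n : ℕ) :
    ((out tie f g v n).energy G : ℝ) + (N : ℝ) * (out tie f g v n).pay Player.min ≤
      arrive u W v - arrive u W (out tie f g v n).cur := by
  have hNr : (0 : ℝ) < N := by exact_mod_cast hN0
  induction n with
  | zero => simp [out, History.energy, History.pay, History.cur]
  | succ n ih =>
    set h := out tie f g v n with hh
    have hgap : halfGap G (arrive u W) next h.cur = richmanBid G u W h.cur := by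
      rw [halfGap, richmanBid, (hnext _).2]
    have hsup : ∀ x, G.Adj h.cur x →
        arrive u W x + arrive u W (next h.cur) + 2 * G.w h.cur ≤ 2 * arrive u W h.cur := by
      intro x hx
      rw [(hnext _).2]
      exact hW.le_arrive hu _ x hx
    have hb : (N : ℝ) * (richmanBid G u W h.cur / N) = richmanBid G u W h.cur :=
      mul_div_cancel₀ _ hNr.ne'
    rw [energy_out_succ]
    push_cast
    rcases out_succ_cases tie f g v n with ⟨-, he⟩ | ⟨hle, he⟩
    · have h1 := add_halfGap_le G hsup
      rw [hgap] at h1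
      rw [he, ← hh, hf, pay_min_step_min, cur_step, mul_add, hb]
      linarith
    · have h1 := le_add_halfGap G hsup (g.move_adj h)
      rw [hgap] at h1
      rw [← hh, hf] at hle
      have h2 := mul_le_mul_of_nonneg_left hle hNr.le
      rw [hb] at h2
      rw [he, ← hh, pay_min_step_max, cur_step, mul_sub]
      linarith

theorem exists_richman_strategy (tie : TieBreak V) (hW : IsWeightedRichman G u W) (hu : W u ≤ 0)
    {B : ℝ} {k N : ℕ} (hB1 : B ≤ 1) (hN0 : 0 < N)
    (hB : ((k : ℝ) + (⨆ v, |richmanBid G u W v|) + ⨆ v, |W v|) / (N : ℝ) < B)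
    (hnext : ∀ v, G.Adj v (next v) ∧ arrive u W (next v) = minSucc G (arrive u W) v) :
    ∃ f : Strategy G,
      (∀ h : History V, f.act h = ⟨richmanBid G u W h.cur / (N : ℝ), next h.cur⟩) ∧
      (∀ (g : Strategy G) (v : V) (n : ℕ),
        ((out tie f g v n).energy G : ℝ) + (N : ℝ) * (out tie f g v n).pay Player.min ≤
          arrive u W v - arrive u W (out tie f g v n).cur) ∧
      (∀ g : Strategy G, LegalMax tie (1 - B) g →
        (∀ n : ℕ,
          ((k : ℝ) + ((out tie f g u n).energy G : ℝ) + ⨆ v, |richmanBid G u W v|) / (N : ℝ) ≤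
            B - (out tie f g u n).pay Player.min) ∧
        (∀ n : ℕ, 0 ≤ (k : ℤ) + (out tie f g u n).energy G →
          (f.act (out tie f g u n)).bid ≤ B - (out tie f g u n).pay Player.min) ∧
        ((∃ n : ℕ, (k : ℤ) + (out tie f g u n).energy G ≤ 0) ∨
          ∀ n : ℕ, (k : ℝ) + ((out tie f g u n).energy G : ℝ) ≤
            (N : ℝ) - ⨆ v, |richmanBid G u W v|)) := by
  set bM := ⨆ v, |richmanBid G u W v| with hbM
  set wM := ⨆ v, |W v| with hwM
  have hNr : (0 : ℝ) < N := by exact_mod_cast hN0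
  have hb : ∀ v, richmanBid G u W v ≤ bM := fun v =>
    (le_abs_self _).trans (le_ciSup (f := fun v => |richmanBid G u W v|)
      (Set.finite_range _).bddAbove v)
  have hw : ∀ v, |W v| ≤ wM := fun v =>
    le_ciSup (f := fun v => |W v|) (Set.finite_range _).bddAbove v
  have hw0 : 0 ≤ wM := (abs_nonneg _).trans (hw u)
  rw [div_lt_iff₀ hNr] at hB
  have hk : (0 : ℝ) ≤ k := k.cast_nonneg
  have hN1 : ∀ v, richmanBid G u W v / N ≤ 1 := fun v => by
    rw [div_le_one₀ hNr]
    nlinarith [hb v]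
  refine ⟨richmanStrategy G u W next (fun v => (hnext v).1) hN1, fun h => rfl, ?_⟩
  have hpot := energy_add_pay_le tie hW hu hnext hN0
    (f := richmanStrategy G u W next (fun v => (hnext v).1) hN1) fun h => rfl
  refine ⟨hpot, fun g hg => ?_⟩
  generalize hf : richmanStrategy G u W next (fun v => (hnext v).1) hN1 = f at hpot
  have hfb : ∀ h, (f.act h).bid = richmanBid G u W h.cur / N := fun h => hf ▸ rfl
  have hbud : ∀ n : ℕ, ((k : ℝ) + ((out tie f g u n).energy G : ℝ) + bM) / (N : ℝ) ≤
      B - (out tie f g u n).pay Player.min := by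
    intro n
    rw [div_le_iff₀ hNr]
    have h1 := hpot g u n
    have h2 : -wM ≤ arrive u W (out tie f g u n).cur := by
      unfold arrive
      split_ifs
      · linarith
      · exact neg_le_of_abs_le (hw _)
    have h3 : arrive u W u = 0 := if_pos rfl
    linarith
  refine ⟨hbud, fun n hn => ?_, Or.inr fun n => ?_⟩
  · refine le_trans ?_ (hbud n)
    rw [hfb]
    have hn' : (0 : ℝ) ≤ k + (out tie f g u n).energy G := by exact_mod_cast hn
    refine div_le_div_of_nonneg_right ?_ hNr.le
    linarith [hb (out tie f g u n).cur]
  · have h1 := (hbud n).trans (budget_le_one tie hg f u n)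
    rw [div_le_one₀ hNr] at h1
    linarith

end Richman

/-! ### Bottom components -/

section Bottom

variable {V : Type u} (G : Game V)

/-- `v` lies in a bottom strongly connected component: from every vertex that can be reached from
`v`, there is a way back to `v`. -/
def IsBottom (v : V) : Prop :=
  ∀ x, Relation.ReflTransGen G.Adj v x → Relation.ReflTransGen G.Adj x v

variable {G}

theorem IsBottom.reach {v x : V} (h : IsBottom G v) (hx : Relation.ReflTransGen G.Adj v x) :
    IsBottom G x :=
  fun y hy => (h y (hx.trans hy)).trans hx

theorem exists_isBottom [Finite V] (v : V) :
    ∃ x, Relation.ReflTransGen G.Adj v x ∧ IsBottom G x := by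
  -- a vertex whose set of reachable vertices is as small as possible
  obtain ⟨x, hx, hmin⟩ := Set.exists_min_image {x | Relation.ReflTransGen G.Adj v x}
    (fun x => {y | Relation.ReflTransGen G.Adj x y}.ncard) (Set.toFinite _)
    ⟨v, Relation.ReflTransGen.refl⟩
  refine ⟨x, hx, fun y hy => ?_⟩
  have hsub : {z | Relation.ReflTransGen G.Adj y z} ⊆ {z | Relation.ReflTransGen G.Adj x z} :=
    fun z hz => hy.trans hz
  have heq := Set.eq_of_subset_of_ncard_le hsub (hmin y (hx.trans hy))
  have hxx : x ∈ {z | Relation.ReflTransGen G.Adj x z} := Relation.ReflTransGen.refl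
  rw [← heq] at hxx
  exact hxx

end Bottom

/-! ### Ergodic constants by vanishing discount -/

section Ergodic

variable {V : Type u}

/-- The mean of the largest and the smallest value of `φ` on the neighbours of `v`. -/
noncomputable def midSucc (G : Game V) (φ : V → ℝ) (v : V) : ℝ :=
  (maxSucc G φ v + minSucc G φ v) / 2

variable [Finite V] (G : Game V)

theorem midSucc_mono {φ ψ : V → ℝ} {v : V} (h : ∀ x, G.Adj v x → φ x ≤ ψ x) :
    midSucc G φ v ≤ midSucc G ψ v := by
  have h1 := maxSucc_mono G h
  have h2 := minSucc_mono G h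
  unfold midSucc; linarith

theorem midSucc_congr_add {φ ψ : V → ℝ} {v : V} {c : ℝ} (h : ∀ x, G.Adj v x → ψ x = φ x + c) :
    midSucc G ψ v = midSucc G φ v + c := by
  rw [midSucc, maxSucc_congr_add G h, minSucc_congr_add G h, midSucc]; ring

theorem midSucc_const {φ : V → ℝ} {v : V} {c : ℝ} (h : ∀ x, G.Adj v x → φ x = c) :
    midSucc G φ v = c := by
  have h1 : maxSucc G φ v ≤ c := maxSucc_le G fun x hx => (h x hx).le
  have h2 : c ≤ minSucc G φ v := le_minSucc G fun x hx => (h x hx).ge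
  have h3 := minSucc_le_maxSucc G (φ := φ) (v := v)
  unfold midSucc; linarith

theorem midSucc_neg (φ : V → ℝ) (v : V) : midSucc G (fun x => -φ x) v = -midSucc G φ v := by
  rw [midSucc, maxSucc_neg, minSucc_neg, midSucc]; ring

theorem midSucc_one_sub (φ : V → ℝ) (v : V) :
    midSucc G (fun x => 1 - φ x) v = 1 - midSucc G φ v := by
  rw [midSucc_congr_add G (φ := fun x => -φ x) (c := 1) fun x _ => by ring, midSucc_neg]; ring

theorem abs_midSucc_sub_le {φ ψ : V → ℝ} {c : ℝ} (h : ∀ x, |φ x - ψ x| ≤ c) (v : V) :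
    |midSucc G φ v - midSucc G ψ v| ≤ c := by
  have h1 : midSucc G φ v ≤ midSucc G (fun x => ψ x + c) v :=
    midSucc_mono G fun x _ => by linarith [le_of_abs_le (h x)]
  have h2 : midSucc G ψ v ≤ midSucc G (fun x => φ x + c) v :=
    midSucc_mono G fun x _ => by linarith [neg_le_of_abs_le (h x)]
  rw [midSucc_congr_add G fun x _ => rfl] at h1 h2
  rw [abs_le]
  constructor <;> linarith

theorem abs_midSucc_le {φ : V → ℝ} {c : ℝ} (h : ∀ x, |φ x| ≤ c) (v : V) :
    |midSucc G φ v| ≤ c := by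
  have h1 := abs_midSucc_sub_le G (φ := φ) (ψ := fun _ => 0) (by simpa using h) v
  rwa [midSucc_const G (φ := fun _ => 0) fun _ _ => rfl, sub_zero] at h1

theorem exists_discounted (w : V → ℝ) {δ : ℝ} (hδ : 0 < δ) :
    ∃ q : V → ℝ, ∀ v, midSucc G q v + w v = q v + δ * q v := by
  have := Fintype.ofFinite V
  have hδ1 : 0 < 1 + δ := by linarith
  have hK : ContractingWith (1 + δ)⁻¹.toNNReal
      (fun (q : V → ℝ) v => (1 + δ)⁻¹ * (midSucc G q v + w v)) := by
    refine ⟨?_, LipschitzWith.of_dist_le_mul fun φ ψ => ?_⟩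
    · rw [Real.toNNReal_lt_one]
      exact inv_lt_one_of_one_lt₀ (by linarith)
    · rw [Real.coe_toNNReal _ (inv_pos.2 hδ1).le]
      refine (dist_pi_le_iff (by positivity)).2 fun v => ?_
      rw [Real.dist_eq, ← mul_sub, abs_mul, abs_of_pos (inv_pos.2 hδ1), add_sub_add_right_eq_sub]
      refine mul_le_mul_of_nonneg_left ?_ (inv_pos.2 hδ1).le
      exact abs_midSucc_sub_le G (fun x => by rw [← Real.dist_eq]; exact dist_le_pi_dist φ ψ x) v
  refine ⟨ContractingWith.fixedPoint _ hK, fun v => ?_⟩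
  have h := congrFun hK.fixedPoint_isFixedPt v
  simp only at h
  rw [inv_mul_eq_iff_eq_mul₀ hδ1.ne'] at h
  rw [h]; ring

theorem discounted_bound {w q : V → ℝ} {δ C : ℝ} (hδ : 0 < δ) (hw : ∀ v, |w v| ≤ C)
    (hq : ∀ v, midSucc G q v + w v = q v + δ * q v) (v : V) : |δ * q v| ≤ C := by
  have : Nonempty V := ⟨v⟩
  obtain ⟨x, hx⟩ := Finite.exists_max fun x => |q x|
  have h1 := abs_midSucc_le G hx x
  have h2 := abs_add_le (midSucc G q x) (w x)
  rw [hq, show q x + δ * q x = (1 + δ) * q x by ring, abs_mul, abs_of_pos (by linarith)] at h2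
  rw [abs_mul, abs_of_pos hδ]
  have h3 := mul_le_mul_of_nonneg_left (hx v) hδ.le
  linarith [hw x]

/-- Solutions of the discounted equations have an oscillation on each bottom component that is
bounded independently of the discount: at a minimum no neighbour can be much larger, as otherwise
the mean would be too large, and this propagates along paths. -/
theorem exists_oscillation_bound {w : V → ℝ} {C : ℝ} (hw : ∀ v, |w v| ≤ C) :
    ∃ R, 0 ≤ R ∧ ∀ (q : V → ℝ) (δ : ℝ), 0 < δ →
      (∀ v, midSucc G q v + w v = q v + δ * q v) →
      ∀ z x, Relation.ReflTransGen G.Adj z x →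
        (∀ y, Relation.ReflTransGen G.Adj z y → q z ≤ q y) → q x - q z ≤ R := by
  have hpath : ∀ z x, ∃ R, Relation.ReflTransGen G.Adj z x → ∀ (q : V → ℝ) (δ : ℝ), 0 < δ →
      (∀ v, midSucc G q v + w v = q v + δ * q v) →
        (∀ y, Relation.ReflTransGen G.Adj z y → q z ≤ q y) → q x - q z ≤ R := by
    intro z x
    by_cases hzx : Relation.ReflTransGen G.Adj z x
    · induction hzx with
      | refl => exact ⟨0, fun _ q δ _ _ _ => by simp⟩
      | @tail x x' hzx hx ih =>
        obtain ⟨R, hR⟩ := ih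
        refine ⟨2 * R + 4 * C, fun _ q δ hδ hq hmin => ?_⟩
        have h1 := hR hzx q δ hδ hq hmin
        have h2 : q z ≤ minSucc G q x := le_minSucc G fun y hy => hmin y (hzx.tail hy)
        have h3 := le_maxSucc G (φ := q) hx
        have h4 := hq x
        have h5 := le_of_abs_le (discounted_bound G hδ hw hq x)
        have h6 := neg_le_of_abs_le (hw x)
        unfold midSucc at h4
        linarith
    · exact ⟨0, fun h => absurd h hzx⟩
  choose R hR using hpath
  obtain ⟨C', hC'0, hC'⟩ := exists_abs_le fun p : V × V => R p.1 p.2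
  exact ⟨C', hC'0, fun q δ hδ hq z x hzx hmin =>
    (hR z x hzx q δ hδ hq hmin).trans (le_of_abs_le (hC' (z, x)))⟩

/-- The ergodic equation: on the bottom components, there is a solution `Y` of the Richman equation
with weights `w - g`, where `g` is constant on each component. It is obtained as a limit of
normalized solutions of the discounted equations. -/
theorem exists_ergodic (w : V → ℝ) :
    ∃ Y g : V → ℝ, (∀ v x, IsBottom G v → G.Adj v x → g x = g v) ∧
      ∀ v, IsBottom G v → midSucc G Y v + w v = Y v + g v := by
  classical
  have := Fintype.ofFinite V
  obtain ⟨C, hC0, hw⟩ := exists_abs_le w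
  obtain ⟨R, hR0, hR⟩ := exists_oscillation_bound G hw
  set δ : ℕ → ℝ := fun n => 1 / ((n : ℝ) + 1) with hδ
  have hδ0 : ∀ n, 0 < δ n := fun n => Nat.one_div_pos_of_nat
  choose q hq using fun n => exists_discounted G w (hδ0 n)
  -- normalize by the minimum on the component
  set m : ℕ → V → ℝ := fun n v => ⨅ x : {x // Relation.ReflTransGen G.Adj v x}, q n x with hm
  have hosc : ∀ n v, IsBottom G v → 0 ≤ q n v - m n v ∧ q n v - m n v ≤ R := by
    intro n v hv
    have : Nonempty {x // Relation.ReflTransGen G.Adj v x} := ⟨⟨v, Relation.ReflTransGen.refl⟩⟩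
    obtain ⟨z, hz⟩ := exists_eq_ciInf_of_finite
      (f := fun x : {x // Relation.ReflTransGen G.Adj v x} => q n x)
    have hle : ∀ y, Relation.ReflTransGen G.Adj v y → q n z ≤ q n y := fun y hy => by
      rw [hz]
      exact ciInf_le (f := fun x : {x // Relation.ReflTransGen G.Adj v x} => q n x)
        (Set.finite_range _).bddBelow ⟨y, hy⟩
    have hmz : m n v = q n z := hz.symm
    rw [hmz]
    exact ⟨sub_nonneg.2 (hle v Relation.ReflTransGen.refl),
      hR (q n) (δ n) (hδ0 n) (hq n) z v (hv z z.2) fun y hy => hle y (z.2.trans hy)⟩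
  have hmadj : ∀ n v x, IsBottom G v → G.Adj v x → m n x = m n v := by
    intro n v x hv hx
    have heq : (fun y => Relation.ReflTransGen G.Adj x y) =
        fun y => Relation.ReflTransGen G.Adj v y := by
      funext y
      exact propext ⟨fun h => (Relation.ReflTransGen.single hx).trans h,
        fun h => (hv x (Relation.ReflTransGen.single hx)).trans h⟩
    change (⨅ y : Subtype fun y => Relation.ReflTransGen G.Adj x y, q n y) =
      ⨅ y : Subtype fun y => Relation.ReflTransGen G.Adj v y, q n y
    rw [heq]
  set p : ℕ → (V → ℝ) × (V → ℝ) := fun n =>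
    (fun v => if IsBottom G v then q n v - m n v else 0, fun v => δ n * q n v) with hp
  have hbdd : ∀ n, p n ∈ Metric.closedBall (0 : (V → ℝ) × (V → ℝ)) (max R C) := by
    intro n
    rw [mem_closedBall_zero_iff, Prod.norm_def]
    refine max_le_max ?_ ?_
    · refine (pi_norm_le_iff_of_nonneg hR0).2 fun v => ?_
      simp only [hp]
      split_ifs with hv
      · rw [Real.norm_eq_abs, abs_of_nonneg (hosc n v hv).1]
        exact (hosc n v hv).2
      · simpa using hR0
    · exact (pi_norm_le_iff_of_nonneg hC0).2 fun v => discounted_bound G (hδ0 n) hw (hq n) v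
  obtain ⟨⟨Y, g⟩, -, κ, hκ, hlim⟩ := tendsto_subseq_of_bounded Metric.isBounded_closedBall hbdd
  rw [Prod.tendsto_iff] at hlim
  obtain ⟨hY, hg⟩ := hlim
  have hg' := tendsto_pi_nhds.1 hg
  have hY' := tendsto_pi_nhds.1 hY
  refine ⟨Y, g, fun v x hv hx => ?_, fun v hv => ?_⟩
  · -- `δ * (q x - q v)` tends to `0` as the oscillation is bounded
    refine tendsto_nhds_unique (hg' x) ?_
    have hxb := hv.reach (Relation.ReflTransGen.single hx)
    have h0 : Tendsto (fun n => δ (κ n) * (q (κ n) x - q (κ n) v)) atTop (nhds 0) := by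
      have hδlim : Tendsto (fun n => δ (κ n) * R) atTop (nhds 0) := by
        simpa [hδ, Function.comp_def] using
          (tendsto_one_div_add_atTop_nhds_zero_nat (𝕜 := ℝ).comp hκ.tendsto_atTop).mul_const R
      refine squeeze_zero_norm (fun n => ?_) hδlim
      rw [Real.norm_eq_abs, abs_mul, abs_of_pos (hδ0 _)]
      refine mul_le_mul_of_nonneg_left ?_ (hδ0 _).le
      have h1 := hosc (κ n) v hv
      have h2 := hosc (κ n) x hxb
      rw [hmadj _ v x hv hx] at h2
      rw [abs_le]
      constructor <;> linarith
    have h1 := (hg' v).add h0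
    rw [add_zero] at h1
    refine h1.congr fun n => ?_
    simp only [hp, Function.comp]
    ring
  · have hcont : Continuous fun φ : V → ℝ => midSucc G φ v := by
      refine (LipschitzWith.of_dist_le_mul (K := 1) fun φ ψ => ?_).continuous
      rw [Real.dist_eq, NNReal.coe_one, one_mul]
      exact abs_midSucc_sub_le G
        (fun x => by rw [← Real.dist_eq]; exact dist_le_pi_dist φ ψ x) v
    refine tendsto_nhds_unique (((hcont.tendsto Y).comp hY).add_const (w v))
      (((hY' v).add (hg' v)).congr fun n => ?_)
    simp only [hp, Function.comp, if_pos hv]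
    rw [midSucc_congr_add G (φ := q (κ n)) (c := -m (κ n) v)]
    · linarith [hq (κ n) v]
    · intro x hx
      rw [if_pos (hv.reach (Relation.ReflTransGen.single hx)), hmadj _ v x hv hx]
      ring

end Ergodic

/-! ### Threshold functions and the construction of certificates -/

section Threshold

variable {V : Type u} [Finite V] (G : Game V)

/-- The Richman equation for reachability: a fixed point with values in `[0,1]` for the boundary
values `0` and `1` on a set `S`. -/
theorem exists_richman (S good : V → Prop) :
    ∃ θ : V → ℝ, (∀ v, 0 ≤ θ v ∧ θ v ≤ 1) ∧ (∀ v, S v → good v → θ v = 0) ∧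
      (∀ v, S v → ¬ good v → θ v = 1) ∧ ∀ v, ¬ S v → midSucc G θ v = θ v := by
  classical
  have hmem : ∀ (φ : V → Set.Icc (0 : ℝ) 1) (v : V),
      midSucc G (fun x => (φ x : ℝ)) v ∈ Set.Icc (0 : ℝ) 1 := by
    intro φ v
    have h1 : minSucc G (fun x => (φ x : ℝ)) v ≤ _ := minSucc_le_maxSucc G
    have h2 : (0 : ℝ) ≤ minSucc G (fun x => (φ x : ℝ)) v := le_minSucc G fun x _ => (φ x).2.1
    have h3 : maxSucc G (fun x => (φ x : ℝ)) v ≤ 1 := maxSucc_le G fun x _ => (φ x).2.2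
    unfold midSucc
    constructor <;> linarith
  let F : (V → Set.Icc (0 : ℝ) 1) →o (V → Set.Icc (0 : ℝ) 1) :=
    { toFun := fun φ v => if S v then (if good v then 0 else 1)
        else ⟨midSucc G (fun x => (φ x : ℝ)) v, hmem φ v⟩
      monotone' := fun φ ψ h v => by
        dsimp only
        split_ifs
        · exact le_rfl
        · exact le_rfl
        · exact midSucc_mono G fun x _ => h x }
  have hF : ∀ v, F.lfp v = if S v then (if good v then 0 else 1)
      else ⟨midSucc G (fun x => (F.lfp x : ℝ)) v, hmem F.lfp v⟩ :=
    fun v => (congrFun F.map_lfp v).symm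
  refine ⟨fun v => F.lfp v, fun v => (F.lfp v).2, fun v hv hgood => ?_, fun v hv hgood => ?_,
    fun v hv => ?_⟩
  · dsimp only; rw [hF, if_pos hv, if_pos hgood]; rfl
  · dsimp only; rw [hF, if_pos hv, if_neg hgood]; rfl
  · have h := congrArg Subtype.val (hF v)
    rw [if_neg hv] at h
    exact h.symm

variable {G}

/-- Distances along a relation `M` to a set `A`. -/
theorem exists_rank {V : Type u} (M : V → V → Prop) (A : V → Prop) :
    ∃ d : V → ℕ, ∀ v, ¬ A v → (∃ a, A a ∧ Relation.ReflTransGen M v a) →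
      ∃ x, M v x ∧ (∃ a, A a ∧ Relation.ReflTransGen M x a) ∧ d x < d v := by
  classical
  let S : ℕ → Set V := fun n =>
    n.rec {v | A v} fun _ T => T ∪ {v | ∃ x, M v x ∧ x ∈ T}
  have hS : ∀ v, (∃ a, A a ∧ Relation.ReflTransGen M v a) → ∃ n, v ∈ S n := by
    rintro v ⟨a, ha, hva⟩
    induction hva using Relation.ReflTransGen.head_induction_on with
    | refl => exact ⟨0, ha⟩
    | head h _ ih =>
      obtain ⟨n, hn⟩ := ih
      exact ⟨n + 1, Or.inr ⟨_, h, hn⟩⟩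
  have hS' : ∀ n v, v ∈ S n → ∃ a, A a ∧ Relation.ReflTransGen M v a := by
    intro n
    induction n with
    | zero => exact fun v hv => ⟨v, hv, Relation.ReflTransGen.refl⟩
    | succ n ih =>
      rintro v (hv | ⟨x, hx, hxn⟩)
      · exact ih v hv
      · obtain ⟨a, ha, hxa⟩ := ih x hxn
        exact ⟨a, ha, hxa.head hx⟩
  refine ⟨fun v => sInf {n | v ∈ S n}, fun v hvA hv => ?_⟩
  have hmin : v ∈ S (sInf {n | v ∈ S n}) := Nat.sInf_mem (hS v hv)
  rcases hn : sInf {n | v ∈ S n} with _ | n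
  · rw [hn] at hmin; exact absurd hmin hvA
  · rw [hn] at hmin
    rcases hmin with h | ⟨x, hx, hxn⟩
    · have : sInf {n | v ∈ S n} ≤ n := Nat.sInf_le h
      omega
    · refine ⟨x, hx, hS' n x hxn, ?_⟩
      change sInf {n | x ∈ S n} < sInf {n | v ∈ S n}
      rw [hn]
      exact Nat.lt_succ_of_le (Nat.sInf_le hxn)

/-- From each vertex with `θ v < 1`, a bottom vertex with `θ = 0` can be reached along edges to
neighbours that minimize `θ`. Otherwise, let `v` be a counterexample with the least `θ v`. Then `θ`
has to be constant on all vertices that can be reached from `v`, all of which are counterexamples,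
but some of which are bottom vertices. -/
theorem exists_minimizing_path {θ : V → ℝ} (hmid : ∀ v, midSucc G θ v = θ v)
    (hbot : ∀ v, IsBottom G v → θ v = 0 ∨ θ v = 1) {v : V} (hv : θ v < 1) :
    ∃ a, (IsBottom G a ∧ θ a = 0) ∧
      Relation.ReflTransGen (fun v x => G.Adj v x ∧ θ x = minSucc G θ v) v a := by
  by_contra hneg
  set M : V → V → Prop := fun v x => G.Adj v x ∧ θ x = minSucc G θ v with hM
  set S : Set V := {v | ¬ ∃ a, (IsBottom G a ∧ θ a = 0) ∧ Relation.ReflTransGen M v a} with hS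
  have hSM : ∀ x z, x ∈ S → M x z → z ∈ S := by
    rintro x z hx hxz ⟨a, ha, hza⟩
    exact hx ⟨a, ha, hza.head hxz⟩
  obtain ⟨z, hzS, hz⟩ := Set.exists_min_image S θ (Set.toFinite _) ⟨v, hneg⟩
  have hreach : ∀ x, Relation.ReflTransGen G.Adj z x → x ∈ S ∧ θ x = θ z := by
    intro x hx
    induction hx with
    | refl => exact ⟨hzS, rfl⟩
    | @tail x x' _ hx ih =>
      obtain ⟨hxS, hxθ⟩ := ih
      obtain ⟨y, hy, hy'⟩ := exists_eq_minSucc G θ x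
      have h1 := hz y (hSM x y hxS ⟨hy, hy'⟩)
      have h2 := hmid x
      have h3 := le_maxSucc G (φ := θ) hx
      have h4 := minSucc_le G (φ := θ) hx
      unfold midSucc at h2
      refine ⟨hSM x x' hxS ⟨hx, ?_⟩, ?_⟩ <;> linarith
  obtain ⟨b, hzb, hb⟩ := exists_isBottom (G := G) z
  obtain ⟨hbS, hbθ⟩ := hreach b hzb
  have h1 := hz v hneg
  rcases hbot b hb with h | h
  · exact hbS ⟨b, ⟨hb, h⟩, Relation.ReflTransGen.refl⟩
  · linarith

/-- A potential `Y₀` on the bottom vertices with `θ = 0` extends to a certificate. Elsewhere, the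
potential increases with the distance `d` along edges that minimize `θ`; it is `A₀ + D * (1 - p)`
with `p = 3⁻ᵈ`, so that the gain of a step by which `d` decreases outweighs the loss of an arbitrary
step. -/
theorem exists_isCertificate {y θ Y₀ : V → ℝ} (hθ : ∀ v, 0 ≤ θ v ∧ θ v ≤ 1)
    (hmid : ∀ v, midSucc G θ v = θ v) (hbot : ∀ v, IsBottom G v → θ v = 0 ∨ θ v = 1)
    (hY₀ : ∀ v, IsBottom G v → θ v = 0 → midSucc G Y₀ v + y v ≤ Y₀ v) :
    ∃ Y next, IsCertificate G y θ Y next := by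
  classical
  set M : V → V → Prop := fun v x => G.Adj v x ∧ θ x = minSucc G θ v with hM
  set A : V → Prop := fun v => IsBottom G v ∧ θ v = 0 with hA
  have hAadj : ∀ v x, A v → G.Adj v x → A x := by
    rintro v x ⟨hv, hv0⟩ hx
    refine ⟨hv.reach (Relation.ReflTransGen.single hx), le_antisymm ?_ (hθ x).1⟩
    have h1 := hmid v
    have h2 := le_maxSucc G (φ := θ) hx
    have h3 : 0 ≤ minSucc G θ v := le_minSucc G fun x _ => (hθ x).1
    unfold midSucc at h1
    linarith
  obtain ⟨d, hd⟩ := exists_rank M A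
  have hpath : ∀ v, θ v < 1 → ∃ a, A a ∧ Relation.ReflTransGen M v a :=
    fun v hv => exists_minimizing_path hmid hbot hv
  obtain ⟨A₀, hA₀, hYA⟩ := exists_abs_le Y₀
  obtain ⟨D, hD0, hD⟩ := exists_abs_le fun v => 2 * y v * 3 ^ d v
  set p : V → ℝ := fun v =>
    if ∃ a, A a ∧ Relation.ReflTransGen M v a then (1 / 3) ^ d v else 0 with hp
  have hp0 : ∀ v, 0 ≤ p v := fun v => by simp only [hp]; split_ifs <;> positivity
  have hp1 : ∀ v, p v ≤ 1 := fun v => by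
    simp only [hp]
    split_ifs
    · exact pow_le_one₀ (by norm_num) (by norm_num)
    · exact zero_le_one
  have hnext : ∀ v, ∃ x, G.Adj v x ∧ θ x = minSucc G θ v ∧ (A v → Y₀ x = minSucc G Y₀ v) ∧
      (¬ A v → θ v < 1 → 3 * p v ≤ p x) := by
    intro v
    by_cases hv : A v
    · obtain ⟨x, hx, hx'⟩ := exists_eq_minSucc G Y₀ v
      obtain ⟨z, hz, hz'⟩ := exists_eq_minSucc G θ v
      refine ⟨x, hx, ?_, fun _ => hx', fun h => absurd hv h⟩
      rw [← hz', (hAadj v x hv hx).2, (hAadj v z hv hz).2]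
    · by_cases hv1 : θ v < 1
      · obtain ⟨x, ⟨hx, hx'⟩, hxA, hlt⟩ := hd v hv (hpath v hv1)
        refine ⟨x, hx, hx', fun h => absurd h hv, fun _ _ => ?_⟩
        simp only [hp]
        rw [if_pos (hpath v hv1), if_pos hxA]
        have h1 : ((1 : ℝ) / 3) ^ d v ≤ (1 / 3) ^ (d x + 1) :=
          pow_le_pow_of_le_one (by norm_num) (by norm_num) hlt
        rw [pow_succ] at h1
        linarith
      · obtain ⟨x, hx, hx'⟩ := exists_eq_minSucc G θ v
        exact ⟨x, hx, hx', fun h => absurd h hv, fun _ h => absurd h hv1⟩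
  choose next hadj hnθ hnY hnp using hnext
  set Y : V → ℝ := fun v => if A v then Y₀ v else A₀ + D * (1 - p v) with hY
  have hYle : ∀ v, Y v ≤ A₀ + D * (1 - p v) := by
    intro v
    simp only [hY]
    split_ifs
    · have := mul_nonneg hD0 (sub_nonneg.2 (hp1 v))
      linarith [le_of_abs_le (hYA v)]
    · exact le_rfl
  refine ⟨Y, next, hadj, fun v => (hθ v).1, fun v => (hθ v).2, fun v x hx => ?_,
    fun v x hv1 hx => ?_⟩
  · have h1 := hmid v
    have h2 := le_maxSucc G (φ := θ) hx
    unfold midSucc at h1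
    rw [hnθ]; linarith
  · by_cases hv : A v
    · have h1 := hY₀ v hv.1 hv.2
      have h2 := le_maxSucc G (φ := Y₀) hx
      have h3 := hnY v hv
      simp only [hY]
      rw [if_pos hv, if_pos (hAadj v x hv hx), if_pos (hAadj v _ hv (hadj v)), h3]
      unfold midSucc at h1
      linarith
    · have h1 := hYle x
      have h2 := hYle (next v)
      have h3 : Y v = A₀ + D * (1 - p v) := if_neg hv
      have h4 := mul_le_mul_of_nonneg_left (hnp v hv hv1) hD0
      have h5 := mul_nonneg hD0 (hp0 x)
      have h6 : 2 * y v ≤ D * p v := by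
        simp only [hp]
        rw [if_pos (hpath v hv1), one_div, inv_pow, ← div_eq_mul_inv, le_div_iff₀ (by positivity)]
        exact le_of_abs_le (hD v)
      rw [h3]
      linarith

end Threshold

/-! ### Games of arbitrary shape -/

section Main

variable {V : Type u} [Finite V]

/-- Both players have certificates, for complementary threshold functions. -/
theorem exists_certificates (G : Game V) :
    ∃ (θ Y Y' : V → ℝ) (next next' : V → V) (ε : ℝ), 0 < ε ∧
      IsCertificate G (fun v => (G.w v : ℝ)) θ Y next ∧
      IsCertificate G (fun v => ε - G.w v) (fun v => 1 - θ v) Y' next' := by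
  obtain ⟨Y₀, g, hg, hY₀⟩ := exists_ergodic G fun v => (G.w v : ℝ)
  obtain ⟨θ, hθ, hgood, hbad, hmid⟩ := exists_richman G (IsBottom G) fun v => g v ≤ 0
  have hbot : ∀ v, IsBottom G v → θ v = 0 ∨ θ v = 1 := fun v hv => by
    by_cases h : g v ≤ 0
    · exact Or.inl (hgood v hv h)
    · exact Or.inr (hbad v hv h)
  have hmid' : ∀ v, midSucc G θ v = θ v := by
    intro v
    by_cases hv : IsBottom G v
    · refine midSucc_const G fun x hx => ?_
      have hxb := hv.reach (Relation.ReflTransGen.single hx)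
      by_cases h : g v ≤ 0
      · rw [hgood v hv h, hgood x hxb (hg v x hv hx ▸ h)]
      · rw [hbad v hv h, hbad x hxb (hg v x hv hx ▸ h)]
    · exact hmid v hv
  -- the least positive ergodic constant
  obtain ⟨ε, hε, hεg⟩ : ∃ ε : ℝ, 0 < ε ∧ ∀ v, 0 < g v → ε ≤ g v := by
    rcases Set.eq_empty_or_nonempty {v | 0 < g v} with h | h
    · exact ⟨1, one_pos, fun v hv => absurd hv (Set.eq_empty_iff_forall_notMem.1 h v)⟩
    · obtain ⟨z, hz, hmin⟩ := Set.exists_min_image {v | 0 < g v} g (Set.toFinite _) h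
      exact ⟨g z, hz, hmin⟩
  obtain ⟨Y, next, hc⟩ := exists_isCertificate (G := G) (y := fun v => (G.w v : ℝ)) (Y₀ := Y₀)
    hθ hmid' hbot fun v hv h0 => by
      have h1 : g v ≤ 0 := by
        by_contra h
        rw [hbad v hv h] at h0
        exact one_ne_zero h0
      linarith [hY₀ v hv]
  obtain ⟨Y', next', hc'⟩ := exists_isCertificate (G := G) (y := fun v => ε - G.w v)
    (θ := fun v => 1 - θ v) (Y₀ := fun v => -Y₀ v)
    (fun v => ⟨by linarith [(hθ v).2], by linarith [(hθ v).1]⟩)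
    (fun v => by rw [midSucc_one_sub, hmid'])
    (fun v hv => by rcases hbot v hv with h | h <;> simp [h])
    fun v hv h0 => by
      have h1 : 0 < g v := by
        by_contra h
        rw [hgood v hv (not_lt.1 h)] at h0
        norm_num at h0
      rw [midSucc_neg]
      linarith [hY₀ v hv, hεg v h1]
  exact ⟨θ, Y, Y', next, next', ε, hε, hc, hc'⟩

/-- Max's certificate shows that Min cannot do with less than `θ v`. -/
theorem IsCertificate.le_thresh {G : Game V} {tie : TieBreak V} {θ Y : V → ℝ} {next : V → V}
    {ε : ℝ} (hε : 0 < ε)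
    (hc : IsCertificate G (fun v => ε - G.w v) (fun v => 1 - θ v) Y next) (v : V) :
    θ v ≤ thresh G tie v := by
  refine le_csInf ⟨1, zero_le_one, le_rfl, fun B h1 h2 => absurd h1 (not_lt.2 h2)⟩ ?_
  rintro t ⟨-, -, ht⟩
  by_contra hlt
  obtain ⟨B, htB, hBθ⟩ := exists_between (not_le.1 hlt)
  obtain ⟨f, hf, hfv⟩ := ht B htB (by linarith [hc.nonneg v])
  obtain ⟨g, hg, hgv⟩ := hc.exists_maxGuarantees hε tie (v := v) (B := 1 - B) (by linarith)
  exact absurd (hfv g hg) (not_le.2 (hgv f (by rwa [sub_sub_cancel])))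

end Main

end BidMP

open BidMP in
theorem mainTheorem1 :
    -- `K` is the constant bounding the number of polynomials of each simple bid function
    ∃ K : ℕ, ∀ (V : Type u) [Finite V] (G : Game V) (tie : TieBreak V),
      -- above the threshold budget, a memoryless strategy guarantees a non-positive value
      (∀ (v : V) (B : ℝ), thresh G tie v < B → B ≤ 1 →
        ∃ f : Strategy G, IsMemoryless K B f ∧ MinGuarantees tie v B f) ∧
      -- the explicit strategy in a strongly connected game with `W(u) ≤ 0`
      (StronglyConnected G → ∀ (u : V) (W : V → ℝ), IsWeightedRichman G u W → W u ≤ 0 →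
        ∀ (B : ℝ) (k N : ℕ), B ≤ 1 → 0 < N →
          ((k : ℝ) + (⨆ v, |richmanBid G u W v|) + ⨆ v, |W v|) / (N : ℝ) < B →
        ∀ next : V → V,
          (∀ v, G.Adj v (next v) ∧ arrive u W (next v) = minSucc G (arrive u W) v) →
        ∃ f : Strategy G,
          (∀ h : History V, f.act h = ⟨richmanBid G u W h.cur / (N : ℝ), next h.cur⟩) ∧
          -- energy is tied to budget, from every vertex and against every Max strategy
          (∀ (g : Strategy G) (v : V) (n : ℕ),
            ((out tie f g v n).energy G : ℝ) + (N : ℝ) * (out tie f g v n).pay Player.min ≤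
              arrive u W v - arrive u W (out tie f g v n).cur) ∧
          (∀ g : Strategy G, LegalMax tie (1 - B) g →
            -- upon reaching energy `e`, Min's budget is at least `(e + b_M) / N`
            (∀ n : ℕ,
              ((k : ℝ) + ((out tie f g u n).energy G : ℝ) + ⨆ v, |richmanBid G u W v|) / (N : ℝ) ≤
                B - (out tie f g u n).pay Player.min) ∧
            -- as long as the energy is non-negative, Min can afford his bid
            (∀ n : ℕ, 0 ≤ (k : ℤ) + (out tie f g u n).energy G →
              (f.act (out tie f g u n)).bid ≤ B - (out tie f g u n).pay Player.min) ∧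
            -- the energy reaches `0` or stays bounded
            ((∃ n : ℕ, (k : ℤ) + (out tie f g u n).energy G ≤ 0) ∨
              ∀ n : ℕ, (k : ℝ) + ((out tie f g u n).energy G : ℝ) ≤
                (N : ℝ) - ⨆ v, |richmanBid G u W v|))) := by
  refine ⟨4, fun V _ G tie => ⟨fun v B hv _ => ?_, fun _ u W hW hu B k N hB1 hN hB next hnext =>
    exists_richman_strategy tie hW hu hB1 hN hB hnext⟩⟩
  obtain ⟨θ, Y, Y', next, next', ε, hε, hc, hc'⟩ := exists_certificates G
  exact hc.exists_minGuarantees tie ((hc'.le_thresh hε v).trans_lt hv)
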